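/- **Theorem (Universal approximation property of $G$-causal normalizing flows).** Let $G$ be a directed graph on $\{1,\dots,d\}$ all of whose edges $(i,j)$ satisfy $i<j$ (a sorted DAG), let $\mathrm{PA}(k)$ be the set of parents of $k$, and write $x_A=(x_i)_{i\in A}$; $\|\cdot\|$ is the Euclidean norm. *$G$-compatible distributions.* A probability measure $\mu$ on $\mathbb R^d$ is $G$-compatible if there are a random vector $X\sim\mu$, mutually independent real random variables $U_1,\dots,U_d$ and measurable $f_i$ with $X_i=f_i(X_{\mathrm{PA}(i)},U_i)$ a.s. for all $i$. $\mathcal P_{G,1}(\mathbb R^d)$ is the set of $G$-compatible $\mu$ with finite first moment. *$G$-causal Wasserstein distance.* A coupling $\pi$ of $\mu$ and $\nu$ is $G$-causal if there are $(X,X')\sim\pi$, real random variables $U_1,\dots,U_d$ such that $X,U_1,\dots,U_d$ are mutually independent, and measurable $g_i$ with $X'_i=g_i(X_i,X_{\mathrm{PA}(i)},X'_{\mathrm{PA}(i)},U_i)$ a.s. for all $i$. It is $G$-bicausal if moreover the law of $(X',X)$ is $G$-causal. Put $W_G(\mu,\nu)=\inf_\pi\int\|x-x'\|\,\pi(dx,dx')$,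 the infimum over all $G$-bicausal couplings of $\mu$ and $\nu$. *$G$-causal normalizing flows.* For $\alpha\in(0,1)$ let $\rho_\alpha(x)=\tfrac12\ell(1+x)-\tfrac12\ell(1-x)$, where $\ell(x)=x$ for $x\ge0$ and $\ell(x)=(\alpha-1)x$ for $x<0$. For $n\ge1$ and $\theta=(w^{(1)},b^{(1)},w^{(2)},b^{(2)})\in\Theta(n):=\mathbb R_{>0}^n\times\mathbb R^n\times\mathbb R_{>0}^n\times\mathbb R$ let $g_\alpha(x;\theta)=\sum_{i=1}^n w^{(2)}_i\rho_\alpha(w^{(1)}_ix+b^{(1)}_i)+b^{(2)}$. Let $\sigma:\mathbb R\to\mathbb R$ be measurable, locally essentially bounded and not almost everywhere equal to a polynomial. A $\sigma$-MLP $\mathbb R^p\to\mathbb R^q$ is a map $z\mapsto\sum_{j=1}^m c_j\,\sigma(\langle a_j,z\rangle+b_j)+c_0$ with $m\in\mathbb N$, $a_j\in\mathbb R^p$, $b_j\in\mathbb R$, $c_j\in\mathbb R^q$. A $G$-causal normalizing flow with parameters $\alpha,\sigma$ is a composition $\hat T=\hat T^{(d)}\circ\dots\circ\hat T^{(1)}$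 of maps $\mathbb R^d\to\mathbb R^d$, where $\hat T^{(k)}$ replaces the coordinate $x_k$ by $g_\alpha(x_k;\theta_k(x_{\mathrm{PA}(k)}))$ and leaves the other coordinates unchanged, for some $n_k\ge1$ and some $\sigma$-MLP $\theta_k:\mathbb R^{|\mathrm{PA}(k)|}\to\mathbb R^{3n_k+1}$ all of whose values lie in $\Theta(n_k)$. *Statement.* Let $\mu\in\mathcal P_{G,1}(\mathbb R^d)$ be absolutely continuous with compact support, and assume that for every $k$ the conditional cdf $(x_k,x_{\mathrm{PA}(k)})\mapsto F_k(x_k\mid x_{\mathrm{PA}(k)})$ (determined for almost every $x_{\mathrm{PA}(k)}$) has a version in $C^1(\mathbb R\times\mathbb R^{|\mathrm{PA}(k)|})$. Let $\sigma$ be as above. Then for every $\varepsilon>0$ there is $\alpha_0\in(0,1)$ such that for every $\alpha\in(0,\alpha_0]$ there is a $G$-causal normalizing flow $\hat T$ with parameters $\alpha,\sigma$ such that $\hat T_\#\mathcal U([0,1]^d)\in\mathcal P_{G,1}(\mathbb R^d)$ and $$W_G\big(\mu,\hat T_\#\mathcal U([0,1]^d)\big)\le\varepsilon .$$ In other words,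 $G$-causal normalizing flows (with $\alpha$ ranging over $(0,1)$) approximate every such $\mu$ arbitrarily well in $(\mathcal P_{G,1}(\mathbb R^d),W_G)$. -/

import Mathlib

noncomputable section

namespace GCausal

open MeasureTheory ProbabilityTheory

/-! `ℝ^d` is modelled by `Fin d → ℝ` with its Borel σ-algebra and Lebesgue measure; since the norm
that Mathlib puts on this type is the sup norm, the Euclidean norm is written out. -/

/-- The Euclidean norm on `ℝ^d`. -/
def euclNorm {d : ℕ} (x : Fin d → ℝ) : ℝ := ‖(WithLp.toLp 2 x : EuclideanSpace ℝ (Fin d))‖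

/-- A directed graph on `{1, …, d}` is a sorted DAG if every edge `(i, j)` satisfies `i < j`. -/
def IsSortedDAG {d : ℕ} (G : Digraph (Fin d)) : Prop := ∀ i j, G.Adj i j → i < j

open Classical in
/-- The parents of the vertex `k`. -/
def parents {d : ℕ} (G : Digraph (Fin d)) (k : Fin d) : Finset (Fin d) :=
  Finset.univ.filter fun i => G.Adj i k

/-- The slice of `x` along the parents of `k`. -/
def slice {d : ℕ} (G : Digraph (Fin d)) (k : Fin d) (x : Fin d → ℝ) : parents G k → ℝ :=
  fun i => x i

/-! ### Distributions compatible with the graph -/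

/-- `μ` is the law of a structural causal model on `G`: it is the law of some random vector `X`
with `X_i = f_i(X_PA(i), U_i)` for measurable `f_i` and mutually independent `U_1, …, U_d`. -/
def IsGCompatible {d : ℕ} (G : Digraph (Fin d)) (μ : Measure (Fin d → ℝ)) : Prop :=
  ∃ (Ω : Type) (_ : MeasurableSpace Ω) (P : Measure Ω) (X : Ω → Fin d → ℝ) (U : Fin d → Ω → ℝ)
    (f : ∀ i : Fin d, (parents G i → ℝ) × ℝ → ℝ),
    IsProbabilityMeasure P ∧ Measurable X ∧ (∀ i, Measurable (U i)) ∧ (∀ i, Measurable (f i)) ∧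
    P.map X = μ ∧ iIndepFun U P ∧
    ∀ i, ∀ᵐ ω ∂P, X ω i = f i (slice G i (X ω), U i ω)

/-- The set of `G`-compatible probability measures on `ℝ^d` with finite first moment. -/
def PG1 {d : ℕ} (G : Digraph (Fin d)) : Set (Measure (Fin d → ℝ)) :=
  {μ | IsProbabilityMeasure μ ∧ IsGCompatible G μ ∧ Integrable euclNorm μ}

/-! ### The `G`-causal Wasserstein distance -/

/-- `π` is `G`-causal: it is the law of some pair `(X, X')` with
`X'_i = g_i(X_i, X_PA(i), X'_PA(i), U_i)` for measurable `g_i`, where `X, U_1, …, U_d` are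
mutually independent. -/
def IsGCausal {d : ℕ} (G : Digraph (Fin d)) (π : Measure ((Fin d → ℝ) × (Fin d → ℝ))) : Prop :=
  ∃ (Ω : Type) (_ : MeasurableSpace Ω) (P : Measure Ω) (X X' : Ω → Fin d → ℝ)
    (U : Fin d → Ω → ℝ)
    (g : ∀ i : Fin d, ℝ × (parents G i → ℝ) × (parents G i → ℝ) × ℝ → ℝ),
    IsProbabilityMeasure P ∧ Measurable X ∧ Measurable X' ∧ (∀ i, Measurable (U i)) ∧
    (∀ i, Measurable (g i)) ∧
    P.map (fun ω => (X ω, X' ω)) = π ∧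
    iIndepFun U P ∧ IndepFun X (fun ω i => U i ω) P ∧
    ∀ i, ∀ᵐ ω ∂P, X' ω i = g i (X ω i, slice G i (X ω), slice G i (X' ω), U i ω)

/-- The set of `G`-bicausal couplings of `μ` and `ν`. -/
def bicausalCouplings {d : ℕ} (G : Digraph (Fin d)) (μ ν : Measure (Fin d → ℝ)) :
    Set (Measure ((Fin d → ℝ) × (Fin d → ℝ))) :=
  {π | π.map Prod.fst = μ ∧ π.map Prod.snd = ν ∧
    IsGCausal G π ∧ IsGCausal G (π.map Prod.swap)}

/-- The `G`-causal Wasserstein distance, with value `∞` if there is no coupling of finite cost. -/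
def WG {d : ℕ} (G : Digraph (Fin d)) (μ ν : Measure (Fin d → ℝ)) : ENNReal :=
  ⨅ π ∈ bicausalCouplings G μ ν, ∫⁻ p, ENNReal.ofReal (euclNorm (p.1 - p.2)) ∂π

/-! ### Conditional distribution functions -/

/-- The joint law of `(X_PA(k), X_k)` for `X ∼ μ`. -/
def parentLaw {d : ℕ} (G : Digraph (Fin d)) (μ : Measure (Fin d → ℝ)) (k : Fin d) :
    Measure ((parents G k → ℝ) × ℝ) :=
  μ.map fun x => (slice G k x, x k)

/-- The conditional cdf `(x_k, x_PA(k)) ↦ F_k(x_k | x_PA(k))`, which is determined only for almost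
every `x_PA(k)`, has a version in `C¹(ℝ × ℝ^|PA(k)|)`. -/
def HasC1CondCDF {d : ℕ} (G : Digraph (Fin d)) (μ : Measure (Fin d → ℝ)) (k : Fin d) : Prop :=
  ∃ F : ℝ × (parents G k → ℝ) → ℝ, ContDiff ℝ 1 F ∧
    ∀ᵐ z ∂(parentLaw G μ k).fst, ∀ t : ℝ, F (t, z) = condCDF (parentLaw G μ k) z t

/-! ### Monotone shallow networks -/

/-- `LeakyReLU_a(x) = x` for `x ≥ 0` and `a x` for `x < 0`. -/
def leakyReLU (a x : ℝ) : ℝ := if 0 ≤ x then x else a * x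

/-- The activation function of the monotone networks. -/
def rho (α x : ℝ) : ℝ :=
  1 / 2 * leakyReLU (α - 1) (1 + x) - 1 / 2 * leakyReLU (α - 1) (1 - x)

/-- The space of all tuples `(w¹, b¹, w², b²)`, without sign conditions. -/
abbrev RawParam (n : ℕ) : Type := (Fin n → ℝ) × (Fin n → ℝ) × (Fin n → ℝ) × ℝ

/-- The parameter space `Θ(n) = ℝ_{>0}^n × ℝ^n × ℝ_{>0}^n × ℝ`. -/
def Theta (n : ℕ) : Set (RawParam n) :=
  {θ | (∀ i, 0 < θ.1 i) ∧ ∀ i, 0 < θ.2.2.1 i}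

/-- `g(x, θ) = ∑ i, w²_i ρ(w¹_i x + b¹_i) + b²`. -/
def incrMLP (α : ℝ) {n : ℕ} (x : ℝ) (θ : RawParam n) : ℝ :=
  ∑ i, θ.2.2.1 i * rho α (θ.1 i * x + θ.2.1 i) + θ.2.2.2

/-! ### Hypernetworks and flows -/

/-- Admissible activation functions of the hypernetworks: (Borel) measurable, locally essentially
bounded, and not almost everywhere equal to a polynomial. -/
structure IsMLPActivation (σ : ℝ → ℝ) : Prop where
  measurable : Measurable σ
  locally_essBounded : ∀ K : Set ℝ, IsCompact K → MemLp σ ⊤ (volume.restrict K)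
  not_polynomial : ¬ ∃ p : Polynomial ℝ, ∀ᵐ x, σ x = p.eval x

/-- `θ : ℝ^ι → E` is a multilayer perceptron with one hidden layer, activation `σ` and affine
output layer. -/
def IsMLP {ι E : Type} [Fintype ι] [AddCommGroup E] [Module ℝ E] (σ : ℝ → ℝ)
    (θ : (ι → ℝ) → E) : Prop :=
  ∃ (m : ℕ) (a : Fin m → ι → ℝ) (b : Fin m → ℝ) (c : Fin m → E) (c₀ : E),
    ∀ z, θ z = ∑ j, σ (∑ i, a j i * z i + b j) • c j + c₀

/-- `T` is a hypercoupling layer at coordinate `k`: it replaces `x_k` by `g(x_k; θ(x_PA(k)))` and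
leaves the other coordinates unchanged; `g` has `n ≥ 1` neurons and `θ` is an MLP with values in
`Θ(n)`. -/
def IsHyperCoupling {d : ℕ} (G : Digraph (Fin d)) (α : ℝ) (σ : ℝ → ℝ) (k : Fin d)
    (T : (Fin d → ℝ) → (Fin d → ℝ)) : Prop :=
  ∃ n : ℕ, 0 < n ∧ ∃ θ : (parents G k → ℝ) → RawParam n,
    IsMLP σ θ ∧ (∀ z, θ z ∈ Theta n) ∧
    ∀ x, T x = Function.update x k (incrMLP α (x k) (θ (slice G k x)))

/-- `T = T^(d) ∘ ⋯ ∘ T^(1)`, where `T^(k)` is a hypercoupling layer at coordinate `k`. -/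
def IsGCausalNF {d : ℕ} (G : Digraph (Fin d)) (α : ℝ) (σ : ℝ → ℝ)
    (T : (Fin d → ℝ) → (Fin d → ℝ)) : Prop :=
  ∃ L : Fin d → (Fin d → ℝ) → (Fin d → ℝ), (∀ k, IsHyperCoupling G α σ k (L k)) ∧
    ∀ x, T x = (List.finRange d).foldl (fun y k => L k y) x

/-- The uniform distribution on the cube `[0,1]^d`. -/
def unifCube (d : ℕ) : Measure (Fin d → ℝ) := volume.restrict (Set.Icc 0 1)

end GCausal

end

noncomputable section

namespace GCausal

open MeasureTheory ProbabilityTheory Filter Topology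

section

/-! ### Solutions of structural causal models -/

-- Let X solve a structural causal model with law μ, and put U_k = F_k(X_k | X_PA(k)), the
-- Rosenblatt transform. Given all noise variables other than the k-th, U_k is uniform
-- (`lintegral_rosenblatt`), so U is uniform on the cube (`map_rosenblatt`). A flow T with strictly
-- increasing layers therefore couples X with T(U), and this coupling is bicausal
-- (`map_mem_bicausalCouplings`). Forwards, T(U)_k is a function of U_k and T(U)_PA(k) by
-- construction. Backwards, T(U)_k determines U_k because the layer is injective, and U_k determines
-- X_k because almost surely F_k is strictly smaller to the left of X_k. Hence W_G is at most the
-- sum of the means of |X_k - T(U)_k| (`WG_le_sum`), and it remains to choose T with these means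
-- small.
--
-- No conditional quantile function, which may be discontinuous, has to be approximated. On a grid
-- y_i of mesh h, X_k is within h of a sum of jumps of height h at the points y_i < X_k, and almost
-- surely y_i < X_k holds exactly when F_k(y_i | X_PA(k)) < U_k. So the target is a staircase in U_k
-- whose jump positions are the C¹ functions F_k(y_i | ·). A layer imitates it by steep neurons with
-- constant positive weights and biases proportional to perceptrons in the parents, which makes the
-- sign conditions automatic (`isLayer_stepLayer`). Smoothing a jump over width 1/w matters only
-- with probability of order 1/w, as U_k is uniform; an error in a jump position costs a factor w,
-- and the leak of the activation costs αw (`meanLE_stepLayer`).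
--
-- The perceptrons read the generated parents T(U)_PA(k). Their approximation holds in mean under
-- the law of these parents (`exists_isMLP_lintegral_le`), which is bounded and absolutely
-- continuous because layers expand distances on each line, hence pull null sets back to null sets.
-- The difference between true and generated parents is absorbed by a Lipschitz bound for F_k on a
-- compact box. `exists_layers` carries out the induction over the coordinates.

/-- The update of the coordinate `k` by the structural equation `f k`. -/
def scmStep {d : ℕ} (G : Digraph (Fin d)) (f : ∀ i : Fin d, (parents G i → ℝ) × ℝ → ℝ)
    (k : Fin d) (y : Fin d → ℝ) : Fin d → ℝ :=
  Function.update y k (f k (slice G k y, y k))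

/-- The solution of the structural causal model with structural equations `f` and noise `v`. -/
def scm {d : ℕ} (G : Digraph (Fin d)) (f : ∀ i : Fin d, (parents G i → ℝ) × ℝ → ℝ)
    (v : Fin d → ℝ) : Fin d → ℝ :=
  (List.finRange d).foldl (fun y k => scmStep G f k y) v

variable {d : ℕ} {G : Digraph (Fin d)}

lemma adj_of_mem_parents {k : Fin d} (i : parents G k) : G.Adj i k := by
  have := i.2
  simpa [parents] using this

lemma slice_congr {k : Fin d} {x y : Fin d → ℝ} (h : ∀ i, G.Adj i k → x i = y i) :
    slice G k x = slice G k y := by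
  funext i
  exact h _ (adj_of_mem_parents i)

lemma slice_congr_of_lt (hG : IsSortedDAG G) {k : Fin d} {x y : Fin d → ℝ}
    (h : ∀ i < k, x i = y i) : slice G k x = slice G k y :=
  slice_congr fun i hi => h i (hG i k hi)

lemma slice_update (hG : IsSortedDAG G) (k : Fin d) (x : Fin d → ℝ) (y : ℝ) :
    slice G k (Function.update x k y) = slice G k x :=
  slice_congr_of_lt hG fun _ hi => Function.update_of_ne hi.ne _ _

@[fun_prop]
lemma measurable_slice (k : Fin d) : Measurable (slice G k) :=
  measurable_pi_lambda _ fun _ => measurable_pi_apply _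

lemma measurable_scmStep {f : ∀ i : Fin d, (parents G i → ℝ) × ℝ → ℝ}
    (hf : ∀ i, Measurable (f i)) (k : Fin d) : Measurable (scmStep G f k) := by
  refine measurable_pi_lambda _ fun j => ?_
  by_cases h : j = k
  · subst h
    simp only [scmStep, Function.update_self]
    exact (hf j).comp ((measurable_slice j).prodMk (measurable_pi_apply j))
  · simp only [scmStep, Function.update_of_ne h]
    exact measurable_pi_apply j

lemma measurable_scm {f : ∀ i : Fin d, (parents G i → ℝ) × ℝ → ℝ}
    (hf : ∀ i, Measurable (f i)) : Measurable (scm G f) := by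
  have : ∀ l : List (Fin d), Measurable fun v : Fin d → ℝ =>
      l.foldl (fun y k => scmStep G f k y) v := by
    intro l
    induction l with
    | nil => exact measurable_id
    | cons k l ih => exact ih.comp (measurable_scmStep hf k)
  exact this _

/-- In an increasing list, a coordinate still holds its noise when its turn comes, its parents are
never changed afterwards, and neither is the coordinate itself. The induction peels off the last
update. -/
lemma foldl_scmStep (hG : IsSortedDAG G) (f : ∀ i : Fin d, (parents G i → ℝ) × ℝ → ℝ)
    (v : Fin d → ℝ) (l : List (Fin d)) (hl : l.Pairwise (· < ·)) :
    (∀ k, k ∉ l → l.foldl (fun y k => scmStep G f k y) v k = v k) ∧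
    ∀ k ∈ l, l.foldl (fun y k => scmStep G f k y) v k =
      f k (slice G k (l.foldl (fun y k => scmStep G f k y) v), v k) := by
  induction l using List.reverseRecOn with
  | nil => simp
  | append_singleton l a ih =>
    rw [List.pairwise_append] at hl
    obtain ⟨ih1, ih2⟩ := ih hl.1
    have hlt : ∀ k ∈ l, k < a := fun k hk => hl.2.2 k hk a (by simp)
    have ha : a ∉ l := fun h => lt_irrefl _ (hlt a h)
    simp only [List.foldl_append, List.foldl_cons, List.foldl_nil]
    set y := l.foldl (fun y k => scmStep G f k y) v with hy
    refine ⟨fun k hk => ?_, fun k hk => ?_⟩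
    · simp only [List.mem_append, List.mem_singleton, not_or] at hk
      rw [scmStep, Function.update_of_ne hk.2]
      exact ih1 k hk.1
    · have hs : ∀ k ≤ a, slice G k (scmStep G f a y) = slice G k y := fun k hk =>
        slice_congr_of_lt hG fun i hi => by
          rw [scmStep, Function.update_of_ne (hi.trans_le hk).ne]
      rcases List.mem_append.1 hk with hk | hk
      · rw [hs k (hlt k hk).le, ← ih2 k hk, scmStep, Function.update_of_ne (hlt k hk).ne]
      · obtain rfl : k = a := by simpa using hk
        rw [hs k le_rfl, scmStep, Function.update_self, ih1 k ha]

lemma scm_apply (hG : IsSortedDAG G) (f : ∀ i : Fin d, (parents G i → ℝ) × ℝ → ℝ)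
    (v : Fin d → ℝ) (k : Fin d) : scm G f v k = f k (slice G k (scm G f v), v k) :=
  (foldl_scmStep hG f v (List.finRange d) (List.pairwise_lt_finRange d)).2 k
    (List.mem_finRange k)

/-- Uniqueness, by strong induction along the order. It turns structural equations that hold almost
surely into an explicit function of the noise. -/
lemma eq_scm (hG : IsSortedDAG G) {f : ∀ i : Fin d, (parents G i → ℝ) × ℝ → ℝ}
    {v x : Fin d → ℝ} (h : ∀ k, x k = f k (slice G k x, v k)) : x = scm G f v := by
  funext k
  induction k using WellFoundedLT.induction with
  | ind k ih =>
    rw [h k, scm_apply hG f v k, slice_congr_of_lt hG ih]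

lemma scm_congr (hG : IsSortedDAG G) {f f' : ∀ i : Fin d, (parents G i → ℝ) × ℝ → ℝ}
    {v v' : Fin d → ℝ} {k : Fin d} (hf : ∀ j ≤ k, f j = f' j) (hv : ∀ j ≤ k, v j = v' j) :
    scm G f v k = scm G f' v' k := by
  induction k using WellFoundedLT.induction with
  | ind k ih =>
    rw [scm_apply hG f v k, scm_apply hG f' v' k, hf k le_rfl, hv k le_rfl,
      slice_congr_of_lt hG fun i hi => ih i hi (fun j hj => hf j (hj.trans hi.le))
        fun j hj => hv j (hj.trans hi.le)]

lemma scm_update_of_lt (hG : IsSortedDAG G) (f : ∀ i : Fin d, (parents G i → ℝ) × ℝ → ℝ)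
    (v : Fin d → ℝ) {j k : Fin d} (h : j < k) (y : ℝ) :
    scm G f (Function.update v k y) j = scm G f v j :=
  scm_congr hG (fun _ _ => rfl) fun _ hi => Function.update_of_ne (hi.trans_lt h).ne _ _

/-- Parents of k only see noise of smaller index. Together with resampling of the k-th noise, this
encodes the independence of that noise from the parents. -/
lemma slice_scm_update (hG : IsSortedDAG G) (f : ∀ i : Fin d, (parents G i → ℝ) × ℝ → ℝ)
    (v : Fin d → ℝ) (k : Fin d) (y : ℝ) :
    slice G k (scm G f (Function.update v k y)) = slice G k (scm G f v) :=
  slice_congr_of_lt hG fun _ hi => scm_update_of_lt hG f v hi y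

/-- A compatible distribution is the law of the solution of a structural causal model with
independent noise. -/
lemma IsGCompatible.exists_scm (hG : IsSortedDAG G) {μ : Measure (Fin d → ℝ)}
    (hμ : IsGCompatible G μ) :
    ∃ (ν : Fin d → Measure ℝ) (f : ∀ i : Fin d, (parents G i → ℝ) × ℝ → ℝ),
      (∀ i, IsProbabilityMeasure (ν i)) ∧ (∀ i, Measurable (f i)) ∧
      (Measure.pi ν).map (scm G f) = μ := by
  obtain ⟨Ω, _, P, X, U, f, hP, hX, hU, hf, hXμ, hind, hae⟩ := hμ
  refine ⟨fun i => P.map (U i), f, fun i => Measure.isProbabilityMeasure_map (hU i).aemeasurable,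
    hf, ?_⟩
  rw [← (iIndepFun_iff_map_fun_eq_pi_map fun i => (hU i).aemeasurable).1 hind,
    Measure.map_map (measurable_scm hf) (measurable_pi_lambda _ hU), ← hXμ]
  refine Measure.map_congr ?_
  filter_upwards [ae_all_iff.2 hae] with ω hω
  exact (eq_scm hG hω).symm

lemma isGCompatible_map_scm (hG : IsSortedDAG G)
    {f : ∀ i : Fin d, (parents G i → ℝ) × ℝ → ℝ} (hf : ∀ i, Measurable (f i))
    (ν : Fin d → Measure ℝ) [∀ i, IsProbabilityMeasure (ν i)] :
    IsGCompatible G ((Measure.pi ν).map (scm G f)) :=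
  ⟨Fin d → ℝ, inferInstance, Measure.pi ν, scm G f, fun i v => v i, f, inferInstance,
    measurable_scm hf, fun i => measurable_pi_apply i, hf, rfl,
    iIndepFun_pi (X := fun _ => id) fun _ => aemeasurable_id,
    fun i => ae_of_all _ fun v => scm_apply hG f v i⟩

/-- Resampling one coordinate preserves a product measure. -/
lemma measurePreserving_update (ν : Fin d → Measure ℝ) [∀ i, IsProbabilityMeasure (ν i)]
    (k : Fin d) :
    MeasurePreserving (fun p : (Fin d → ℝ) × ℝ => Function.update p.1 k p.2)
      ((Measure.pi ν).prod (ν k)) (Measure.pi ν) := by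
  have hm : Measurable fun p : (Fin d → ℝ) × ℝ => Function.update p.1 k p.2 := by
    refine measurable_pi_lambda _ fun j => ?_
    by_cases h : j = k
    · subst h; simpa using measurable_snd
    · simp only [Function.update_of_ne h]; fun_prop
  refine ⟨hm, (Measure.pi_eq fun s hs => ?_).symm⟩
  rw [Measure.map_apply hm (MeasurableSet.univ_pi hs)]
  have : (fun p : (Fin d → ℝ) × ℝ => Function.update p.1 k p.2) ⁻¹' (Set.univ.pi s) =
      (Set.univ.pi (Function.update s k Set.univ)) ×ˢ s k := by
    ext p
    simp only [Set.mem_preimage, Set.mem_pi, Set.mem_univ, true_implies, Set.mem_prod]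
    constructor
    · refine fun h => ⟨fun i => ?_, by simpa using h k⟩
      by_cases hi : i = k
      · subst hi; simp
      · simpa [hi] using h i
    · rintro ⟨h1, h2⟩ i
      by_cases hi : i = k
      · subst hi; simpa using h2
      · simpa [hi] using h1 i
  rw [this, Measure.prod_prod, Measure.pi_pi, ← Finset.prod_erase_mul _ _ (Finset.mem_univ k),
    ← Finset.prod_erase_mul (f := fun i => ν i (s i)) _ (Finset.mem_univ k)]
  simp only [Function.update_self, measure_univ, mul_one]
  congr 1
  refine Finset.prod_congr rfl fun i hi => ?_
  rw [Function.update_of_ne (Finset.ne_of_mem_erase hi)]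

end

section

/-! ### Density of multilayer perceptrons -/

-- Moments of functions orthogonal to dilations and translations

section Moments

variable {Z : Type*} [MeasurableSpace Z] {m : Measure Z} {s g : Z → ℝ} {R : ℝ}

/-- Differentiation in the dilation parameter under the integral sign brings down a factor s.
Boundedness of s keeps the argument of ψ in a compact interval for dilations within 1 of l, which
gives the domination. -/
lemma integral_deriv_mul_eq_zero (hs : Measurable s) (hR : ∀ᵐ z ∂m, |s z| ≤ R)
    (hg : Integrable g m) {ψ : ℝ → ℝ} (hψ : ContDiff ℝ 1 ψ)
    (h : ∀ l b, ∫ z, ψ (l * s z + b) * g z ∂m = 0) (l b : ℝ) :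
    ∫ z, deriv ψ (l * s z + b) * (s z * g z) ∂m = 0 := by
  have hψ' : Continuous (deriv ψ) := hψ.continuous_deriv le_rfl
  have hR' : ∀ᵐ z ∂m, |s z| ≤ |R| := hR.mono fun z hz => hz.trans (le_abs_self R)
  obtain ⟨C, hC⟩ := (isCompact_Icc (a := -((|l| + 1) * |R| + |b|))
    (b := (|l| + 1) * |R| + |b|)).exists_bound_of_continuousOn hψ'.continuousOn
  obtain ⟨C₀, hC₀⟩ := (isCompact_Icc (a := -((|l| + 1) * |R| + |b|))
    (b := (|l| + 1) * |R| + |b|)).exists_bound_of_continuousOn hψ.continuous.continuousOn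
  have hmem : ∀ z, |s z| ≤ |R| → ∀ x ∈ Metric.ball l 1,
      x * s z + b ∈ Set.Icc (-((|l| + 1) * |R| + |b|)) ((|l| + 1) * |R| + |b|) := by
    intro z hz x hx
    rw [Set.mem_Icc, ← abs_le]
    have hx' : |x| ≤ |l| + 1 := by
      have := abs_sub_abs_le_abs_sub x l
      rw [Metric.mem_ball, Real.dist_eq] at hx
      linarith
    calc |x * s z + b| ≤ |x| * |s z| + |b| := (abs_add_le _ _).trans_eq (by rw [abs_mul])
      _ ≤ _ := by gcongr
  have hmeas : ∀ x : ℝ, AEStronglyMeasurable (fun z => ψ (x * s z + b) * g z) m := fun x =>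
    ((hψ.continuous.measurable.comp ((hs.const_mul x).add_const b)).aestronglyMeasurable).mul
      hg.aestronglyMeasurable
  have hl : l ∈ Metric.ball l 1 := Metric.mem_ball_self one_pos
  have key := hasDerivAt_integral_of_dominated_loc_of_deriv_le (μ := m) (𝕜 := ℝ)
    (F := fun x z => ψ (x * s z + b) * g z)
    (F' := fun x z => deriv ψ (x * s z + b) * (s z * g z)) (x₀ := l)
    (bound := fun z => C * (|R| * |g z|)) (Metric.ball_mem_nhds l one_pos)
    (Eventually.of_forall hmeas)
    (by
      refine (hg.norm.const_mul C₀).mono' (hmeas l) ?_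
      filter_upwards [hR'] with z hz
      rw [norm_mul]
      gcongr
      exact hC₀ _ (hmem z hz l hl))
    (((hψ'.measurable.comp ((hs.const_mul l).add_const b)).aestronglyMeasurable).mul
      (hs.aestronglyMeasurable.mul hg.aestronglyMeasurable))
    (by
      filter_upwards [hR'] with z hz x hx
      rw [norm_mul, norm_mul]
      gcongr
      · exact (norm_nonneg _).trans (hC _ (hmem z hz x hx))
      · exact hC _ (hmem z hz x hx)
      · exact hz
      · exact le_rfl)
    ((hg.abs.const_mul _).const_mul _)
    (by
      refine ae_of_all _ fun z x _ => ?_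
      have h1 : HasDerivAt (fun x : ℝ => x * s z + b) (s z) x := by
        simpa using ((hasDerivAt_id x).mul_const (s z)).add_const b
      have h2 := ((hψ.differentiable one_ne_zero _).hasDerivAt.comp x h1).mul_const (g z)
      simpa [mul_assoc, Function.comp_def] using h2)
  have h0 : HasDerivAt (fun x : ℝ => ∫ z, ψ (x * s z + b) * g z ∂m) 0 l := by
    simp only [h]
    exact hasDerivAt_const l 0
  exact key.2.unique h0

lemma integral_iteratedDeriv_mul_eq_zero (hs : Measurable s) (hR : ∀ᵐ z ∂m, |s z| ≤ R)
    {ψ : ℝ → ℝ} (hψ : ContDiff ℝ (⊤ : ℕ∞) ψ) (n : ℕ) (hg : Integrable g m)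
    (h : ∀ l b, ∫ z, ψ (l * s z + b) * g z ∂m = 0) (l b : ℝ) :
    ∫ z, iteratedDeriv n ψ (l * s z + b) * (s z ^ n * g z) ∂m = 0 := by
  have hint : ∀ n : ℕ, Integrable (fun z => s z ^ n * g z) m := fun n => by
    refine hg.bdd_mul (c := |R| ^ n) (hs.pow_const n).aestronglyMeasurable ?_
    filter_upwards [hR] with z hz
    rw [norm_pow, Real.norm_eq_abs]
    exact pow_le_pow_left₀ (abs_nonneg _) (hz.trans (le_abs_self R)) n
  induction n generalizing l b with
  | zero => simpa using h l b
  | succ n ih =>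
    have := integral_deriv_mul_eq_zero hs hR (hint n) (ψ := iteratedDeriv n ψ)
      (by
        rw [iteratedDeriv_eq_iterate]
        exact (hψ.iterate_deriv n).of_le (by norm_cast)) ih l b
    rw [← iteratedDeriv_succ] at this
    rw [← this]
    refine integral_congr_ae (ae_of_all _ fun z => ?_)
    simp only
    ring

end Moments

lemma exists_polynomial_of_iteratedDeriv_eq_zero (n : ℕ) {ψ : ℝ → ℝ}
    (hψ : ContDiff ℝ (⊤ : ℕ∞) ψ) (h : ∀ x, iteratedDeriv n ψ x = 0) :
    ∃ p : Polynomial ℝ, p.degree < n ∧ ∀ x, ψ x = p.eval x := by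
  induction n generalizing ψ with
  | zero => exact ⟨0, by simp, by simpa using h⟩
  | succ n ih =>
    obtain ⟨q, hq, hq'⟩ := ih (ψ := deriv ψ) (contDiff_infty_iff_deriv.1 hψ).2
      (by simpa [iteratedDeriv_succ'] using h)
    set P : Polynomial ℝ :=
      ∑ i ∈ Finset.range n, Polynomial.monomial (i + 1) (q.coeff i / (i + 1)) with hP
    have hPd : P.derivative = q := by
      have hqn : q.natDegree < n ∨ q = 0 := by
        by_cases h0 : q = 0
        · exact Or.inr h0
        · exact Or.inl ((Polynomial.natDegree_lt_iff_degree_lt h0).2 hq)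
      rw [hP, map_sum]
      have : ∀ i ∈ Finset.range n,
          Polynomial.derivative (Polynomial.monomial (i + 1) (q.coeff i / ((i : ℝ) + 1))) =
            Polynomial.monomial i (q.coeff i) := fun i _ => by
        rw [Polynomial.derivative_monomial]
        congr 1
        push_cast
        field_simp
      rw [Finset.sum_congr rfl this]
      rcases hqn with h1 | h1
      · exact (q.as_sum_range' n h1).symm
      · simp [h1]
    have hd : ∀ x, HasDerivAt (fun x => ψ x - P.eval x) 0 x := fun x => by
      have h1 := ((hψ.differentiable (by simp)) x).hasDerivAt.sub (P.hasDerivAt x)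
      rwa [hPd, hq', sub_self] at h1
    have hconst := is_const_of_deriv_eq_zero (f := fun x => ψ x - P.eval x)
      (fun x => (hd x).differentiableAt) (fun x => (hd x).deriv)
    refine ⟨P + Polynomial.C (ψ 0 - P.eval 0), ?_, fun x => ?_⟩
    · refine (Polynomial.degree_add_le _ _).trans_lt (max_lt ?_ ?_)
      · rw [hP]
        refine (Polynomial.degree_sum_le _ _).trans_lt ?_
        rw [Finset.sup_lt_iff (by exact_mod_cast WithBot.bot_lt_coe (n + 1))]
        intro i hi
        refine (Polynomial.degree_monomial_le _ _).trans_lt ?_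
        rw [Finset.mem_range] at hi
        exact_mod_cast Nat.add_lt_add_right hi 1
      · refine Polynomial.degree_C_le.trans_lt ?_
        exact_mod_cast Nat.succ_pos n
    · have := hconst x 0
      simp
      linarith

/-- A polynomial of degree less than n is the Lagrange interpolation of its values at n points.
Convergence at n fixed points thus identifies the limit everywhere else that convergence holds. -/
lemma ae_polynomial_of_tendsto (n : ℕ) {f : ℝ → ℝ} {p : ℕ → Polynomial ℝ}
    (hp : ∀ i, (p i).degree < n)
    (h : ∀ᵐ x, Tendsto (fun i => (p i).eval x) atTop (𝓝 (f x))) :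
    ∃ q : Polynomial ℝ, ∀ᵐ x, f x = q.eval x := by
  have hinf : {x | Tendsto (fun i => (p i).eval x) atTop (𝓝 (f x))}.Infinite := by
    intro hfin
    have h0 : volume {x | Tendsto (fun i => (p i).eval x) atTop (𝓝 (f x))} = 0 :=
      hfin.measure_zero _
    have h1 := measure_univ_le_add_compl (μ := (volume : Measure ℝ))
      {x | Tendsto (fun i => (p i).eval x) atTop (𝓝 (f x))}
    rw [h0, show volume _ = 0 from h] at h1
    simp at h1
  obtain ⟨t, ht, hcard⟩ := hinf.exists_subset_card_eq n
  refine ⟨Lagrange.interpolate t id f, ?_⟩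
  filter_upwards [h] with x hx
  refine tendsto_nhds_unique hx ?_
  have hpi : ∀ i, (p i).eval x =
      ∑ j ∈ t, (p i).eval j * (Lagrange.basis t id j).eval x := fun i => by
    conv_lhs => rw [Lagrange.eq_interpolate (s := t) (v := id) (f := p i)
      Function.injective_id.injOn (by rw [hcard]; exact hp i)]
    simp [Lagrange.interpolate_apply, Polynomial.eval_finsetSum]
  simp only [hpi, Lagrange.interpolate_apply, Polynomial.eval_finsetSum, Polynomial.eval_mul,
    Polynomial.eval_C]
  exact tendsto_finsetSum _ fun j hj => (ht hj).mul_const _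

lemma IsMLPActivation.ae_bound {σ : ℝ → ℝ} (hσ : IsMLPActivation σ) (R : ℝ) :
    ∃ C, 0 ≤ C ∧ ∀ᵐ x, |x| ≤ R → |σ x| ≤ C := by
  have h := hσ.locally_essBounded (Set.Icc (-R) R) isCompact_Icc
  refine ⟨(eLpNorm σ ⊤ (volume.restrict (Set.Icc (-R) R))).toReal, ENNReal.toReal_nonneg, ?_⟩
  have h1 := ae_le_eLpNormEssSup (f := σ) (μ := volume.restrict (Set.Icc (-R) R))
  rw [ae_restrict_iff' measurableSet_Icc] at h1
  filter_upwards [h1] with x hx hxR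
  have h2 := hx (abs_le.1 hxR)
  rw [← eLpNorm_exponent_top] at h2
  have h3 := ENNReal.toReal_mono h.2.ne h2
  simpa using h3

lemma IsMLPActivation.locallyIntegrable {σ : ℝ → ℝ} (hσ : IsMLPActivation σ) :
    LocallyIntegrable σ := by
  rw [locallyIntegrable_iff]
  intro K hK
  have : IsFiniteMeasure (volume.restrict K) := ⟨by simpa using hK.measure_lt_top⟩
  exact (hσ.locally_essBounded K hK).integrable le_top

/-- The convolution of `σ` with a test function. -/
def mollify (φ σ : ℝ → ℝ) (x : ℝ) : ℝ := ∫ t, φ t * σ (x - t)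

lemma mollify_eq_convolution (φ σ : ℝ → ℝ) :
    mollify φ σ = convolution φ σ (ContinuousLinearMap.lsmul ℝ ℝ) volume := rfl

lemma contDiff_mollify {φ σ : ℝ → ℝ} (hφ : ContDiff ℝ (⊤ : ℕ∞) φ) (hc : HasCompactSupport φ)
    (hσ : LocallyIntegrable σ) : ContDiff ℝ (⊤ : ℕ∞) (mollify φ σ) := by
  rw [mollify_eq_convolution]
  exact hc.contDiff_convolution_left _ hφ hσ

/-- Otherwise every mollification of σ is a polynomial of degree less than n. Mollifications by
shrinking bumps converge to σ almost everywhere, so σ itself would agree almost everywhere with a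
polynomial. -/
lemma IsMLPActivation.exists_iteratedDeriv_mollify_ne_zero {σ : ℝ → ℝ} (hσ : IsMLPActivation σ)
    (n : ℕ) : ∃ φ : ℝ → ℝ, ContDiff ℝ (⊤ : ℕ∞) φ ∧ HasCompactSupport φ ∧
      ∃ b, iteratedDeriv n (mollify φ σ) b ≠ 0 := by
  by_contra! hcon
  -- The ratio of outer to inner radius stays equal to 2, as the almost everywhere convergence below
  -- requires a bounded ratio.
  let B : ℕ → ContDiffBump (0 : ℝ) := fun i =>
    ⟨1 / ((i : ℝ) + 1), 2 / ((i : ℝ) + 1), by positivity, by gcongr; norm_num⟩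
  have hlim : Tendsto (fun i => (B i).rOut) atTop (𝓝 0) := by
    have := (tendsto_one_div_add_atTop_nhds_zero_nat (𝕜 := ℝ)).const_mul 2
    simpa [B, div_eq_mul_inv] using this
  have hae := ContDiffBump.ae_convolution_tendsto_right_of_locallyIntegrable (μ := volume)
    (K := 2) hlim (Eventually.of_forall fun i => le_of_eq (by simp only [B]; ring))
    hσ.locallyIntegrable
  have hpoly : ∀ i, ∃ p : Polynomial ℝ, p.degree < n ∧
      ∀ x, mollify ((B i).normed volume) σ x = p.eval x := fun i =>
    exists_polynomial_of_iteratedDeriv_eq_zero n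
      (contDiff_mollify (B i).contDiff_normed (B i).hasCompactSupport_normed
        hσ.locallyIntegrable)
      (hcon _ (B i).contDiff_normed (B i).hasCompactSupport_normed)
  choose p hp1 hp2 using hpoly
  refine hσ.not_polynomial (ae_polynomial_of_tendsto n hp1 ?_)
  filter_upwards [hae] with x hx
  refine hx.congr fun i => ?_
  rw [← mollify_eq_convolution, hp2]

/-- Fubini: a mollification is a mixture of translates of σ. Since σ is only essentially bounded,
the integrable bound holds for almost every t at fixed z. -/
lemma integral_mollify_mul_eq_zero {Z : Type*} [MeasurableSpace Z] {m : Measure Z} [SFinite m]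
    {s g : Z → ℝ} {R : ℝ} {σ : ℝ → ℝ} (hσ : IsMLPActivation σ)
    (hs : Measurable s) (hR : ∀ᵐ z ∂m, |s z| ≤ R) (hg : Integrable g m)
    (h : ∀ l b, ∫ z, σ (l * s z + b) * g z ∂m = 0)
    {φ : ℝ → ℝ} (hφ : Continuous φ) (hc : HasCompactSupport φ) (l b : ℝ) :
    ∫ z, mollify φ σ (l * s z + b) * g z ∂m = 0 := by
  obtain ⟨D, hD⟩ := hc.isCompact.isBounded.exists_norm_le
  obtain ⟨C, hC0, hC⟩ := hσ.ae_bound (|l| * R + |b| + D)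
  have hmeas : AEStronglyMeasurable
      (fun p : Z × ℝ => φ p.2 * σ (l * s p.1 + b - p.2) * g p.1) (m.prod volume) := by
    refine AEStronglyMeasurable.mul ?_ hg.aestronglyMeasurable.comp_fst
    refine Measurable.aestronglyMeasurable ?_
    refine (hφ.measurable.comp measurable_snd).mul (hσ.measurable.comp ?_)
    exact (((hs.comp measurable_fst).const_mul l).add_const b).sub measurable_snd
  have hbound : ∀ᵐ z ∂m, ∀ᵐ t : ℝ,
      ‖φ t * σ (l * s z + b - t) * g z‖ ≤ C * (‖φ t‖ * ‖g z‖) := by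
    filter_upwards [hR] with z hz
    have h1 : ∀ᵐ t : ℝ, |l * s z + b - t| ≤ |l| * R + |b| + D → |σ (l * s z + b - t)| ≤ C :=
      (Measure.measurePreserving_sub_left volume (l * s z + b)).quasiMeasurePreserving.ae hC
    filter_upwards [h1] with t ht
    rw [norm_mul, norm_mul]
    by_cases h0 : φ t = 0
    · simp [h0]
    · have htD : |t| ≤ D := hD t (subset_tsupport _ h0)
      have h3 : |l * s z + b - t| ≤ |l| * R + |b| + D := by
        calc |l * s z + b - t| ≤ |l * s z| + |b| + |t| :=
              (abs_sub _ _).trans (by gcongr; exact abs_add_le _ _)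
          _ ≤ _ := by rw [abs_mul]; gcongr
      have h4 : ‖σ (l * s z + b - t)‖ ≤ C := ht h3
      calc ‖φ t‖ * ‖σ (l * s z + b - t)‖ * ‖g z‖ ≤ ‖φ t‖ * C * ‖g z‖ := by gcongr
        _ = _ := by ring
  have hint : Integrable (fun p : Z × ℝ => φ p.2 * σ (l * s p.1 + b - p.2) * g p.1)
      (m.prod volume) := by
    rw [integrable_prod_iff hmeas]
    have hφi := (hφ.integrable_of_hasCompactSupport hc (μ := volume)).norm
    have hsec : ∀ᵐ z ∂m, Integrable (fun t : ℝ => φ t * σ (l * s z + b - t) * g z) := by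
      filter_upwards [hbound] with z hz
      refine ((hφi.mul_const ‖g z‖).const_mul C).mono' ?_ hz
      exact ((hφ.measurable.mul (hσ.measurable.comp
        (measurable_const.sub measurable_id))).mul_const _).aestronglyMeasurable
    refine ⟨hsec, (((hg.norm.const_mul (∫ t, ‖φ t‖)).const_mul C)).mono'
      hmeas.norm.integral_prod_right' ?_⟩
    filter_upwards [hbound, hsec] with z hz hz'
    rw [Real.norm_of_nonneg (integral_nonneg fun t => norm_nonneg _)]
    refine (integral_mono_ae hz'.norm ((hφi.mul_const ‖g z‖).const_mul C) hz).trans_eq ?_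
    simp only [integral_const_mul, integral_mul_const]
  have h2 : ∀ z, mollify φ σ (l * s z + b) * g z =
      ∫ t, φ t * σ (l * s z + b - t) * g z := fun z => by
    rw [mollify, integral_mul_const]
  simp only [h2]
  rw [integral_integral_swap hint]
  have h3 : ∀ t : ℝ, ∫ z, φ t * σ (l * s z + b - t) * g z ∂m = 0 := fun t => by
    simp only [mul_assoc, integral_const_mul]
    have := h l (b - t)
    simp only [← add_sub_assoc] at this
    rw [this, mul_zero]
  simp [h3]

/-- If `g` is orthogonal to all dilations and translations of `σ`, composed with `s`, then it is
orthogonal to all powers of `s`. -/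
lemma integral_pow_mul_eq_zero {Z : Type*} [MeasurableSpace Z] {m : Measure Z} [SFinite m]
    {s g : Z → ℝ} {R : ℝ} {σ : ℝ → ℝ} (hσ : IsMLPActivation σ)
    (hs : Measurable s) (hR : ∀ᵐ z ∂m, |s z| ≤ R) (hg : Integrable g m)
    (h : ∀ l b, ∫ z, σ (l * s z + b) * g z ∂m = 0) (n : ℕ) :
    ∫ z, s z ^ n * g z ∂m = 0 := by
  obtain ⟨φ, hφ, hc, b, hb⟩ := hσ.exists_iteratedDeriv_mollify_ne_zero n
  -- At dilation 0 the n-th derivative is the nonzero constant found at b and factors out of the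
  -- integral.
  have := integral_iteratedDeriv_mul_eq_zero hs hR
    (contDiff_mollify hφ hc hσ.locallyIntegrable) n hg
    (integral_mollify_mul_eq_zero hσ hs hR hg h hφ.continuous hc) 0 b
  simp only [zero_mul, zero_add, integral_const_mul] at this
  exact (mul_eq_zero.1 this).resolve_left hb

end

-- Multilayer perceptrons and their density in L²

section

section MLP

variable {ι E E' : Type} [Fintype ι] [AddCommGroup E] [Module ℝ E] [AddCommGroup E'] [Module ℝ E']
  {σ : ℝ → ℝ}

lemma IsMLP.const (σ : ℝ → ℝ) (c : E) : IsMLP σ fun _ : ι → ℝ => c :=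
  ⟨0, fun _ => 0, fun _ => 0, fun _ => 0, c, fun z => by simp⟩

lemma IsMLP.neuron (σ : ℝ → ℝ) (a : ι → ℝ) (b : ℝ) :
    IsMLP σ fun z : ι → ℝ => σ (∑ i, a i * z i + b) :=
  ⟨1, fun _ => a, fun _ => b, fun _ => 1, 0, fun z => by simp⟩

lemma IsMLP.add {θ θ' : (ι → ℝ) → E} (h : IsMLP σ θ) (h' : IsMLP σ θ') :
    IsMLP σ fun z => θ z + θ' z := by
  obtain ⟨m, a, b, c, c₀, h⟩ := h
  obtain ⟨m', a', b', c', c₀', h'⟩ := h'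
  refine ⟨m + m', Fin.append a a', Fin.append b b', Fin.append c c', c₀ + c₀', fun z => ?_⟩
  simp only [Fin.sum_univ_add, Fin.append_left, Fin.append_right, h, h']
  abel

lemma IsMLP.map {θ : (ι → ℝ) → E} (h : IsMLP σ θ) (L : E →ₗ[ℝ] E') :
    IsMLP σ fun z => L (θ z) := by
  obtain ⟨m, a, b, c, c₀, h⟩ := h
  exact ⟨m, a, b, fun j => L (c j), L c₀, fun z => by simp [h]⟩

lemma IsMLP.sum {κ : Type} (s : Finset κ) {θ : κ → (ι → ℝ) → E}
    (h : ∀ i ∈ s, IsMLP σ (θ i)) : IsMLP σ fun z => ∑ i ∈ s, θ i z := by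
  classical
  induction s using Finset.induction_on with
  | empty => simpa using IsMLP.const σ 0
  | insert i s hi ih =>
    simp only [Finset.sum_insert hi]
    exact (h i (by simp)).add (ih fun j hj => h j (by simp [hj]))

lemma IsMLP.measurable {θ : (ι → ℝ) → ℝ} (hσ : IsMLPActivation σ) (h : IsMLP σ θ) :
    Measurable θ := by
  obtain ⟨m, a, b, c, c₀, h⟩ := h
  rw [funext h]
  refine (Finset.measurable_sum _ fun j _ => ?_).add_const _
  refine (hσ.measurable.comp ?_).smul_const _
  fun_prop

lemma measurable_neuron (hσ : IsMLPActivation σ) (a : ι → ℝ) (b : ℝ) :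
    Measurable fun z : ι → ℝ => σ (∑ i, a i * z i + b) :=
  (IsMLP.neuron σ a b).measurable hσ

lemma abs_sum_mul_le {a z : ι → ℝ} {R : ℝ} (hz : ∀ i, |z i| ≤ R) :
    |∑ i, a i * z i| ≤ ∑ i, |a i| * R := by
  refine (Finset.abs_sum_le_sum_abs _ _).trans (Finset.sum_le_sum fun i _ => ?_)
  rw [abs_mul]
  exact mul_le_mul_of_nonneg_left (hz i) (abs_nonneg _)

/-- A surjective linear functional pulls Lebesgue null sets back to null sets, so the essential
bound of σ transfers to the neuron. If a = 0 the argument is the single point b, where only the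
finite value of σ is available. -/
lemma ae_bound_neuron (hσ : IsMLPActivation σ) {m : Measure (ι → ℝ)} (hm : m ≪ volume)
    {R : ℝ} (hR : ∀ᵐ z ∂m, ∀ i, |z i| ≤ R) (a : ι → ℝ) (b : ℝ) :
    ∃ C, ∀ᵐ z ∂m, |σ (∑ i, a i * z i + b)| ≤ C := by
  classical
  by_cases ha : a = 0
  · exact ⟨|σ b|, ae_of_all _ fun z => by simp [ha]⟩
  obtain ⟨i₀, hi₀⟩ : ∃ i, a i ≠ 0 := by
    by_contra! h
    exact ha (funext h)
  obtain ⟨C, -, hC⟩ := hσ.ae_bound (∑ i, |a i| * R + |b|)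
  let L : (ι → ℝ) →ₗ[ℝ] ℝ := ∑ i, a i • LinearMap.proj i
  have hL : ∀ z, L z = ∑ i, a i * z i := fun z => by simp [L]
  have hsurj : Function.Surjective L := fun x =>
    ⟨Pi.single i₀ (x / a i₀), by
      rw [hL, Finset.sum_eq_single i₀]
      · simp; field_simp
      · intro i _ hi; simp [hi]
      · simp⟩
  have h1 : ∀ᵐ x : ℝ, |x + b| ≤ ∑ i, |a i| * R + |b| → |σ (x + b)| ≤ C :=
    (measurePreserving_add_right volume b).quasiMeasurePreserving.ae hC
  have hmeas : MeasurableSet {x : ℝ | |x + b| ≤ ∑ i, |a i| * R + |b| → |σ (x + b)| ≤ C} := by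
    have hσb : Measurable fun x => σ (x + b) := hσ.measurable.comp (measurable_id.add_const b)
    refine MeasurableSet.imp ?_ ?_
    · exact measurableSet_le (by fun_prop) measurable_const
    · exact measurableSet_le hσb.abs measurable_const
  have h2 := hm.ae_le
    ((MeasureTheory.ae_comp_linearMap_mem_iff (L := L) (μ := volume) (ν := volume) hsurj hmeas).2
      h1)
  refine ⟨C, ?_⟩
  filter_upwards [h2, hR] with z hz hzR
  rw [← hL]
  refine hz ((abs_add_le _ _).trans ?_)
  rw [hL]
  gcongr
  exact abs_sum_mul_le hzR

lemma IsMLP.ae_bound {θ : (ι → ℝ) → ℝ} (h : IsMLP σ θ) (hσ : IsMLPActivation σ)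
    {m : Measure (ι → ℝ)} (hm : m ≪ volume) {R : ℝ} (hR : ∀ᵐ z ∂m, ∀ i, |z i| ≤ R) :
    ∃ C, ∀ᵐ z ∂m, |θ z| ≤ C := by
  obtain ⟨n, a, b, c, c₀, h⟩ := h
  choose C hC using fun j => ae_bound_neuron hσ hm hR (a j) (b j)
  refine ⟨∑ j, C j * |c j| + |c₀|, ?_⟩
  filter_upwards [ae_all_iff.2 hC] with z hz
  rw [h]
  refine (abs_add_le _ _).trans ?_
  gcongr
  refine (Finset.abs_sum_le_sum_abs _ _).trans (Finset.sum_le_sum fun j _ => ?_)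
  rw [smul_eq_mul, abs_mul]
  exact mul_le_mul_of_nonneg_right (hz j) (abs_nonneg _)

/-- Summing the exponential series shows that the Fourier transform of g dm vanishes. The finite
measures with densities the positive and negative parts of g then have equal characteristic
functions, hence coincide. -/
lemma ae_eq_zero_of_integral_pow_mul {m : Measure (ι → ℝ)} {g : (ι → ℝ) → ℝ}
    (hg : Integrable g m) {R : ℝ} (hR : ∀ᵐ z ∂m, ∀ i, |z i| ≤ R)
    (h : ∀ (a : ι → ℝ) (n : ℕ), ∫ z, (∑ i, a i * z i) ^ n * g z ∂m = 0) :
    g =ᵐ[m] 0 := by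
  classical
  have hexp : ∀ a : ι → ℝ,
      ∫ z, (g z : ℂ) * Complex.exp ((∑ i, a i * z i : ℝ) * Complex.I) ∂m = 0 := by
    intro a
    set s : (ι → ℝ) → ℝ := fun z => ∑ i, a i * z i with hs
    have hsm : Measurable s := by fun_prop
    set B := |∑ i, |a i| * R|
    have hB : ∀ᵐ z ∂m, |s z| ≤ B := hR.mono fun z hz =>
      (abs_sum_mul_le hz).trans (le_abs_self _)
    let F : ℕ → (ι → ℝ) → ℂ := fun n z =>
      (Complex.I ^ n / (n.factorial : ℂ)) * ((s z ^ n * g z : ℝ) : ℂ)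
    have hint : ∀ n : ℕ, Integrable (fun z => s z ^ n * g z) m := fun n => by
      refine hg.bdd_mul (c := B ^ n) (hsm.pow_const n).aestronglyMeasurable ?_
      filter_upwards [hB] with z hz
      rw [norm_pow, Real.norm_eq_abs]
      exact pow_le_pow_left₀ (abs_nonneg _) hz n
    have hF : ∀ n, Integrable (F n) m := fun n => (hint n).ofReal.const_mul _
    have hnorm : ∀ n, ∫ z, ‖F n z‖ ∂m ≤ B ^ n / n.factorial * ∫ z, ‖g z‖ ∂m := fun n => by
      rw [← integral_const_mul]
      refine integral_mono_ae (hF n).norm (hg.norm.const_mul _) ?_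
      filter_upwards [hB] with z hz
      simp only [F, norm_mul, norm_div, norm_pow, Complex.norm_I, one_pow, Complex.norm_natCast,
        Complex.norm_real, Real.norm_eq_abs]
      rw [← mul_assoc, one_div_mul_eq_div]
      gcongr
    have hsum : Summable fun n => ∫ z, ‖F n z‖ ∂m :=
      Summable.of_nonneg_of_le (fun n => integral_nonneg fun z => norm_nonneg _) hnorm
        ((Real.summable_pow_div_factorial B).mul_right _)
    have h1 := hasSum_integral_of_summable_integral_norm hF hsum
    have h2 : ∀ n, ∫ z, F n z ∂m = 0 := fun n => by
      simp only [F]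
      rw [integral_const_mul, integral_complex_ofReal, h a n]
      simp
    simp only [h2] at h1
    have h3 := h1.unique hasSum_zero
    rw [← h3]
    refine integral_congr_ae (ae_of_all _ fun z => ?_)
    have h4 := (NormedSpace.expSeries_div_hasSum_exp ((s z : ℂ) * Complex.I)).mul_left (g z : ℂ)
    rw [← Complex.exp_eq_exp_ℂ] at h4
    simp only
    rw [← h4.tsum_eq]
    refine tsum_congr fun n => ?_
    simp only [F]
    push_cast
    rw [mul_pow]
    ring
  set mp := m.withDensity fun z => ENNReal.ofReal (g z)
  set mn := m.withDensity fun z => ENNReal.ofReal (-g z)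
  have hp : IsFiniteMeasure mp := isFiniteMeasure_withDensity_ofReal hg.2
  have hn : IsFiniteMeasure mn := isFiniteMeasure_withDensity_ofReal hg.neg.2
  have heq : mp = mn := by
    refine Measure.ext_of_charFunDual (funext fun L => ?_)
    have hL : ∀ z, L z = ∑ i, L (Pi.single i 1) * z i := fun z => by
      conv_lhs => rw [← Finset.univ_sum_single z, map_sum]
      refine Finset.sum_congr rfl fun i _ => ?_
      have : (Pi.single i (z i) : ι → ℝ) = z i • Pi.single i 1 := by
        rw [← Pi.single_smul, smul_eq_mul, mul_one]
      rw [this, map_smul, smul_eq_mul, mul_comm]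
    have hcont : Continuous fun z => Complex.exp (L z * Complex.I) := by fun_prop
    have hi : ∀ f : (ι → ℝ) → ℝ, Integrable f m →
        Integrable (fun z => (f z : ℂ) * Complex.exp (L z * Complex.I)) m := fun f hf => by
      refine hf.ofReal.mul_bdd (c := 1) hcont.aestronglyMeasurable (ae_of_all _ fun z => ?_)
      rw [Complex.norm_exp_ofReal_mul_I]
    have hgn : AEMeasurable (fun z => ENNReal.ofReal (-g z)) m :=
      hg.neg.1.aemeasurable.ennreal_ofReal
    rw [charFunDual_apply, charFunDual_apply,
      integral_withDensity_eq_integral_toReal_smul₀ hg.1.aemeasurable.ennreal_ofReal (by simp),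
      integral_withDensity_eq_integral_toReal_smul₀ hgn (by simp), ← sub_eq_zero]
    simp only [Complex.real_smul, ENNReal.toReal_ofReal']
    rw [← integral_sub (hi _ hg.pos_part) (hi _ hg.neg_part), ← hexp fun i => L (Pi.single i 1)]
    refine integral_congr_ae (ae_of_all _ fun z => ?_)
    simp only [← hL]
    rw [← sub_mul, ← Complex.ofReal_sub, max_zero_sub_max_neg_zero_eq_self]
  have h5 := (withDensity_eq_iff hg.1.aemeasurable.ennreal_ofReal
    hg.neg.1.aemeasurable.ennreal_ofReal hg.lintegral_lt_top.ne).1 heq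
  filter_upwards [h5] with z hz
  rcases le_total 0 (g z) with h0 | h0
  · rw [Pi.neg_apply, ENNReal.ofReal_of_nonpos (neg_nonpos.2 h0), ENNReal.ofReal_eq_zero] at hz
    exact le_antisymm hz h0
  · rw [ENNReal.ofReal_of_nonpos h0, eq_comm, ENNReal.ofReal_eq_zero] at hz
    exact le_antisymm h0 (by simpa using hz)

/-- Universal approximation by multilayer perceptrons, in mean. -/
theorem exists_isMLP_lintegral_le (hσ : IsMLPActivation σ) {m : Measure (ι → ℝ)}
    [IsProbabilityMeasure m] (hm : m ≪ volume) {R : ℝ} (hR : ∀ᵐ z ∂m, ∀ i, |z i| ≤ R)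
    {f : (ι → ℝ) → ℝ} (hf : MemLp f 2 m) {η : ℝ} (hη : 0 < η) :
    ∃ τ : (ι → ℝ) → ℝ, IsMLP σ τ ∧
      ∫⁻ z, ENNReal.ofReal |f z - τ z| ∂m ≤ ENNReal.ofReal η := by
  have hu : ∀ p : (ι → ℝ) × ℝ, MemLp (fun z => σ (∑ i, p.1 i * z i + p.2)) 2 m := fun p => by
    obtain ⟨C, hC⟩ := ae_bound_neuron hσ hm hR p.1 p.2
    exact MemLp.of_bound (measurable_neuron hσ p.1 p.2).aestronglyMeasurable C hC
  let K : Submodule ℝ (Lp ℝ 2 m) := Submodule.span ℝ (Set.range fun p => (hu p).toLp _)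
  have hK : ∀ x ∈ K, ∃ τ : (ι → ℝ) → ℝ, IsMLP σ τ ∧ x =ᵐ[m] τ := by
    intro x hx
    induction hx using Submodule.span_induction with
    | mem x hx =>
      obtain ⟨p, rfl⟩ := hx
      exact ⟨_, IsMLP.neuron σ p.1 p.2, (hu p).coeFn_toLp⟩
    | zero => exact ⟨fun _ => 0, IsMLP.const σ 0, Lp.coeFn_zero _ _ _⟩
    | add x y _ _ hx hy =>
      obtain ⟨τ, h1, h2⟩ := hx
      obtain ⟨τ', h1', h2'⟩ := hy
      exact ⟨_, h1.add h1', (Lp.coeFn_add x y).trans (h2.add h2')⟩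
    | smul c x _ hx =>
      obtain ⟨τ, h1, h2⟩ := hx
      refine ⟨_, h1.map (c • LinearMap.id), (Lp.coeFn_smul c x).trans ?_⟩
      filter_upwards [h2] with z hz
      simp [hz]
  -- An element orthogonal to all neurons has vanishing moments along every direction a, so it is
  -- zero and the span of the neurons is dense.
  have hbot : Kᗮ = ⊥ := by
    rw [Submodule.eq_bot_iff]
    intro g hg
    have hgi : Integrable g m := (Lp.memLp g).integrable one_le_two
    have horth : ∀ (a : ι → ℝ) (b : ℝ), ∫ z, σ (∑ i, a i * z i + b) * g z ∂m = 0 := by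
      intro a b
      have h1 := (Submodule.mem_orthogonal K g).1 hg _
        (Submodule.subset_span (Set.mem_range_self (a, b)))
      rw [L2.inner_def] at h1
      rw [← h1]
      refine integral_congr_ae ?_
      filter_upwards [(hu (a, b)).coeFn_toLp] with z hz
      rw [hz]
      simp [mul_comm]
    have h0 := ae_eq_zero_of_integral_pow_mul hgi hR fun a n => by
      refine integral_pow_mul_eq_zero (s := fun z => ∑ i, a i * z i) hσ (by fun_prop)
        (hR.mono fun z hz => abs_sum_mul_le (z := z) hz) hgi (fun l b => ?_) n
      have := horth (fun i => l * a i) b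
      simpa only [Finset.mul_sum, mul_assoc] using this
    exact (Lp.eq_zero_iff_ae_eq_zero).2 h0
  have hdense := (Submodule.topologicalClosure_eq_top_iff (K := K)).2 hbot
  have hmem : hf.toLp f ∈ closure (K : Set (Lp ℝ 2 m)) := by
    rw [← Submodule.topologicalClosure_coe, hdense]
    trivial
  obtain ⟨x, hx, hdist⟩ := Metric.mem_closure_iff.1 hmem η hη
  obtain ⟨τ, hτ, hxτ⟩ := hK x hx
  refine ⟨τ, hτ, ?_⟩
  have hL2 : eLpNorm (fun z => f z - τ z) 2 m ≤ ENNReal.ofReal η := by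
    rw [← edist_lt_ofReal, Lp.edist_def] at hdist
    refine le_of_eq_of_le (eLpNorm_congr_ae ?_) hdist.le
    filter_upwards [hf.coeFn_toLp, hxτ] with z h1 h2
    simp [h1, h2]
  calc ∫⁻ z, ENNReal.ofReal |f z - τ z| ∂m = eLpNorm (fun z => f z - τ z) 1 m := by
        rw [eLpNorm_one_eq_lintegral_enorm]
        simp only [Real.enorm_eq_ofReal_abs]
    _ ≤ eLpNorm (fun z => f z - τ z) 2 m :=
        eLpNorm_le_eLpNorm_of_exponent_le one_le_two
          (hf.aestronglyMeasurable.sub (hτ.measurable hσ).aestronglyMeasurable)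
    _ ≤ _ := hL2

end MLP

end

section

/-! ### The Rosenblatt transform -/

/-- The cdf may have flat pieces, so it is not inverted. By continuity it takes some value u'
slightly above u at a point t, and the sublevel set at u lies in the half-line up to t. -/
lemma map_cdf_eq_uniform (m : Measure ℝ) [IsProbabilityMeasure m] (hc : Continuous (cdf m)) :
    m.map (cdf m) = volume.restrict (Set.Icc 0 1) := by
  have hfin : IsProbabilityMeasure (m.map (cdf m)) :=
    Measure.isProbabilityMeasure_map hc.measurable.aemeasurable
  refine Measure.ext_of_Iic _ _ fun u => ?_
  rw [Measure.map_apply hc.measurable measurableSet_Iic,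
    Measure.restrict_apply measurableSet_Iic]
  have hex : ∀ a, 0 < a → a < 1 → ∃ t, cdf m t = a := fun a h0 h1 =>
    mem_range_of_exists_le_of_exists_ge hc
      ((tendsto_cdf_atBot m).eventually (eventually_le_nhds h0)).exists
      ((tendsto_cdf_atTop m).eventually (eventually_ge_nhds h1)).exists
  rcases lt_or_ge u 0 with hu | hu
  · have h1 : (cdf m) ⁻¹' Set.Iic u = ∅ := by
      ext x
      simpa using hu.trans_le (cdf_nonneg m x)
    have h2 : Set.Iic u ∩ Set.Icc 0 1 = ∅ := by
      ext x
      simp only [Set.mem_inter_iff, Set.mem_Iic, Set.mem_Icc, Set.mem_empty_iff_false, iff_false]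
      intro h
      linarith [h.1, h.2.1]
    rw [h1, h2]
    simp
  rcases le_or_gt 1 u with hu1 | hu1
  · have h1 : (cdf m) ⁻¹' Set.Iic u = Set.univ := by
      ext x
      simpa using (cdf_le_one m x).trans hu1
    have h2 : Set.Iic u ∩ Set.Icc 0 1 = Set.Icc 0 1 :=
      Set.inter_eq_right.2 fun x hx => hx.2.trans hu1
    rw [h1, h2]
    simp
  have h2 : Set.Iic u ∩ Set.Icc 0 1 = Set.Icc 0 u := by
    ext x
    simp only [Set.mem_inter_iff, Set.mem_Iic, Set.mem_Icc]
    constructor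
    · exact fun h => ⟨h.2.1, h.1⟩
    · exact fun h => ⟨h.2, h.1, h.2.trans hu1.le⟩
  rw [h2, Real.volume_Icc, sub_zero]
  refine le_antisymm ?_ ?_
  · refine ENNReal.le_of_forall_pos_le_add fun δ hδ _ => ?_
    obtain ⟨u', h1, h2⟩ := exists_between (lt_min (lt_add_of_pos_right u
      (show (0 : ℝ) < δ from hδ)) hu1)
    obtain ⟨t, ht⟩ := hex u' (hu.trans_lt h1) (h2.trans_le (min_le_right _ _))
    have hsub : (cdf m) ⁻¹' Set.Iic u ⊆ Set.Iic t := fun x hx => by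
      by_contra hxt
      have := monotone_cdf m (not_le.1 hxt).le
      rw [ht] at this
      exact absurd (h1.trans_le this) (not_lt.2 hx)
    calc m ((cdf m) ⁻¹' Set.Iic u) ≤ m (Set.Iic t) := measure_mono hsub
      _ = ENNReal.ofReal u' := by rw [← ofReal_cdf, ht]
      _ ≤ ENNReal.ofReal (u + δ) := ENNReal.ofReal_le_ofReal (h2.le.trans (min_le_left _ _))
      _ = _ := by rw [ENNReal.ofReal_add hu δ.coe_nonneg, ENNReal.ofReal_coe_nnreal]
  · rcases hu.eq_or_lt with rfl | hu0
    · simp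
    obtain ⟨t, ht⟩ := hex u hu0 hu1
    rw [← ht, ofReal_cdf]
    exact measure_mono fun x hx => monotone_cdf m hx

/-- The law of the cdf has no atoms, so almost surely its value at x differs from its values at all
rationals; a rational between t and x then forces strictness. -/
lemma ae_cdf_lt (m : Measure ℝ) [IsProbabilityMeasure m] (hc : Continuous (cdf m)) :
    ∀ᵐ x ∂m, ∀ t < x, cdf m t < cdf m x := by
  have h : ∀ q : ℚ, ∀ᵐ x ∂m, cdf m x ≠ cdf m q := fun q => by
    have h1 : m.map (cdf m) {cdf m q} = 0 := by
      rw [map_cdf_eq_uniform m hc]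
      exact le_antisymm ((Measure.restrict_apply_le _ _).trans_eq (by simp)) zero_le
    rw [Measure.map_apply hc.measurable (measurableSet_singleton _)] at h1
    exact measure_eq_zero_iff_ae_notMem.1 h1
  filter_upwards [ae_all_iff.2 h] with x hx t ht
  obtain ⟨q, hq1, hq2⟩ := exists_rat_btwn ht
  exact (monotone_cdf m hq1.le).trans_lt
    (lt_of_le_of_ne (monotone_cdf m hq2.le) (hx q).symm)

/-- Given z, the second component is f(z, y) with y independent of z. Comparing integrals settles
rational levels, and right continuity extends this to all t outside a single null set. -/
lemma ae_condCDF_eq_cdf {A : Type*} [MeasurableSpace A] (m : Measure A) [IsProbabilityMeasure m]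
    (ν : Measure ℝ) [IsProbabilityMeasure ν] {f : A × ℝ → ℝ} (hf : Measurable f) :
    ∀ᵐ z ∂m, ∀ t, condCDF ((m.prod ν).map fun p => (p.1, f p)) z t =
      cdf (ν.map fun y => f (z, y)) t := by
  set ρ := (m.prod ν).map fun p => (p.1, f p) with hρ
  have hmap : Measurable fun p : A × ℝ => (p.1, f p) := measurable_fst.prodMk hf
  have hρp : IsProbabilityMeasure ρ := Measure.isProbabilityMeasure_map hmap.aemeasurable
  have hfst : ρ.fst = m := by
    rw [Measure.fst, hρ, Measure.map_map measurable_fst hmap]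
    exact Measure.fst_prod
  have hsec : ∀ z, Measurable fun y => f (z, y) := fun z => hf.comp measurable_prodMk_left
  have hprob : ∀ z, IsProbabilityMeasure (ν.map fun y => f (z, y)) := fun z =>
    Measure.isProbabilityMeasure_map (hsec z).aemeasurable
  have hcdf : ∀ z t, ENNReal.ofReal (cdf (ν.map fun y => f (z, y)) t) =
      ν (Prod.mk z ⁻¹' (f ⁻¹' Set.Iic t)) := fun z t => by
    rw [ofReal_cdf, Measure.map_apply (hsec z) measurableSet_Iic]
    rfl
  have hq : ∀ q : ℚ, ∀ᵐ z ∂m, condCDF ρ z q = cdf (ν.map fun y => f (z, y)) q := fun q => by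
    have hms : MeasurableSet (f ⁻¹' Set.Iic (q : ℝ)) := hf measurableSet_Iic
    have key : (fun z => ENNReal.ofReal (condCDF ρ z q)) =ᵐ[m]
        fun z => ν (Prod.mk z ⁻¹' (f ⁻¹' Set.Iic (q : ℝ))) := by
      refine ae_eq_of_forall_setLIntegral_eq_of_sigmaFinite
        (measurable_condCDF ρ q).ennreal_ofReal (measurable_measure_prodMk_left hms) ?_
      intro s hs _
      have h1 := setLIntegral_condCDF ρ q hs
      rw [hfst] at h1
      rw [h1, hρ, Measure.map_apply hmap (hs.prod measurableSet_Iic),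
        Measure.prod_apply (hmap (hs.prod measurableSet_Iic)), ← lintegral_indicator hs]
      refine lintegral_congr fun z => ?_
      by_cases hz : z ∈ s
      · rw [Set.indicator_of_mem hz]
        congr 1
        ext y
        simp [hz]
      · rw [Set.indicator_of_notMem hz]
        convert measure_empty (μ := ν)
        ext y
        simp [hz]
    filter_upwards [key] with z hz
    rw [← hcdf z q] at hz
    exact (ENNReal.ofReal_eq_ofReal_iff (condCDF_nonneg ρ z q) (cdf_nonneg _ _)).1 hz
  filter_upwards [ae_all_iff.2 hq] with z hz t
  rw [← StieltjesFunction.iInf_rat_gt_eq, ← StieltjesFunction.iInf_rat_gt_eq]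
  exact iInf_congr fun q => hz q

variable {d : ℕ} {G : Digraph (Fin d)}

/-- The coordinatewise application of (versions of) the conditional distribution functions. -/
def rosenblatt (G : Digraph (Fin d)) (F : ∀ k : Fin d, ℝ × (parents G k → ℝ) → ℝ)
    (x : Fin d → ℝ) : Fin d → ℝ := fun k => F k (x k, slice G k x)

lemma measurable_rosenblatt {F : ∀ k : Fin d, ℝ × (parents G k → ℝ) → ℝ}
    (hF : ∀ k, Continuous (F k)) : Measurable (rosenblatt G F) :=
  measurable_pi_lambda _ fun k =>
    (hF k).measurable.comp ((measurable_pi_apply k).prodMk (measurable_slice k))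

lemma unifCube_eq_pi :
    unifCube d = Measure.pi fun _ => volume.restrict (Set.Icc (0 : ℝ) 1) := by
  rw [unifCube, ← Set.pi_univ_Icc]
  exact Measure.restrict_pi_pi (fun _ => volume) _

instance : IsProbabilityMeasure (volume.restrict (Set.Icc (0 : ℝ) 1)) := ⟨by simp⟩

instance : IsProbabilityMeasure (unifCube d) := by
  rw [unifCube_eq_pi]
  infer_instance

variable {ν : Fin d → Measure ℝ}
  {f : ∀ i : Fin d, (parents G i → ℝ) × ℝ → ℝ}
  {F : ∀ k : Fin d, ℝ × (parents G k → ℝ) → ℝ}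

/-- `F k` is a version of the conditional distribution function of the coordinate `k` of the
solution of the structural causal model `f` with noise distribution `ν`. -/
def IsSCMCondCDF (ν : Fin d → Measure ℝ) (f : ∀ i : Fin d, (parents G i → ℝ) × ℝ → ℝ)
    (F : ∀ k : Fin d, ℝ × (parents G k → ℝ) → ℝ) : Prop :=
  ∀ k, ∀ᵐ v ∂(Measure.pi ν), ∀ t,
    F k (t, slice G k (scm G f v)) = cdf ((ν k).map fun y => f k (slice G k (scm G f v), y)) t

lemma IsSCMCondCDF.continuous_cdf (hF : IsSCMCondCDF ν f F) (hFc : ∀ k, Continuous (F k))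
    (k : Fin d) : ∀ᵐ v ∂(Measure.pi ν),
      Continuous (cdf ((ν k).map fun y => f k (slice G k (scm G f v), y))) := by
  filter_upwards [hF k] with v hv
  rw [← funext hv]
  exact (hFc k).comp (by fun_prop)

lemma rosenblatt_scm_update (hG : IsSortedDAG G) (v : Fin d → ℝ) (k : Fin d) (y : ℝ) :
    rosenblatt G F (scm G f (Function.update v k y)) k =
      F k (f k (slice G k (scm G f v), y), slice G k (scm G f v)) := by
  rw [rosenblatt, scm_apply hG, slice_scm_update hG, Function.update_self]

variable [∀ i, IsProbabilityMeasure (ν i)]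

/-- Resampling the k-th noise leaves the law unchanged and the parents fixed, which exhibits that
noise as independent of the parents. -/
lemma parentLaw_map_scm (hG : IsSortedDAG G) (hf : ∀ i, Measurable (f i)) (k : Fin d) :
    parentLaw G ((Measure.pi ν).map (scm G f)) k =
      ((((Measure.pi ν).map fun v => slice G k (scm G f v)).prod (ν k)).map
        fun p => (p.1, f k p)) := by
  have hm := measurable_scm hf
  have hsl : Measurable fun v => slice G k (scm G f v) := (measurable_slice k).comp hm
  have hmap : Measurable fun p : (parents G k → ℝ) × ℝ => (p.1, f k p) :=
    measurable_fst.prodMk (hf k)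
  have hprod : ((Measure.pi ν).map fun v => slice G k (scm G f v)).prod (ν k) =
      ((Measure.pi ν).prod (ν k)).map (Prod.map (fun v => slice G k (scm G f v)) id) := by
    rw [← Measure.map_prod_map _ _ hsl measurable_id, Measure.map_id]
  rw [hprod, Measure.map_map hmap (hsl.prodMap measurable_id), parentLaw,
    Measure.map_map ((measurable_slice k).prodMk (measurable_pi_apply k)) hm]
  conv_lhs => rw [← (measurePreserving_update ν k).map_eq]
  rw [Measure.map_map (((measurable_slice k).prodMk (measurable_pi_apply k)).comp hm)
    (measurePreserving_update ν k).measurable]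
  congr 1
  funext p
  rw [Function.comp_apply, Function.comp_apply, Function.comp_apply]
  change _ = (slice G k (scm G f p.1), f k (slice G k (scm G f p.1), p.2))
  rw [slice_scm_update hG, scm_apply hG, slice_scm_update hG, Function.update_self]

lemma exists_isSCMCondCDF (hG : IsSortedDAG G) (hf : ∀ i, Measurable (f i))
    (h : ∀ k, HasC1CondCDF G ((Measure.pi ν).map (scm G f)) k) :
    ∃ F : ∀ k : Fin d, ℝ × (parents G k → ℝ) → ℝ,
      (∀ k, ContDiff ℝ 1 (F k)) ∧ IsSCMCondCDF ν f F := by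
  choose F hF1 hF2 using h
  refine ⟨F, hF1, fun k => ?_⟩
  have hsl : Measurable fun v => slice G k (scm G f v) :=
    (measurable_slice k).comp (measurable_scm hf)
  have hp : IsProbabilityMeasure ((Measure.pi ν).map fun v => slice G k (scm G f v)) :=
    Measure.isProbabilityMeasure_map hsl.aemeasurable
  have h1 := hF2 k
  rw [parentLaw_map_scm hG hf k] at h1
  have hfst : (((((Measure.pi ν).map fun v => slice G k (scm G f v)).prod (ν k)).map
      fun p => (p.1, f k p))).fst = (Measure.pi ν).map fun v => slice G k (scm G f v) := by
    rw [Measure.fst, Measure.map_map measurable_fst (measurable_fst.prodMk (hf k))]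
    exact Measure.fst_prod
  rw [hfst] at h1
  have h2 := ae_condCDF_eq_cdf ((Measure.pi ν).map fun v => slice G k (scm G f v)) (ν k) (hf k)
  have h3 := ae_of_ae_map hsl.aemeasurable (h1.and h2)
  filter_upwards [h3] with v hv t
  rw [hv.1 t, hv.2 t]

/-- The coordinate `k` of the Rosenblatt transform is uniformly distributed, conditionally on all
the other noise variables. -/
lemma lintegral_rosenblatt (hG : IsSortedDAG G) (hf : ∀ i, Measurable (f i))
    (hF : IsSCMCondCDF ν f F) (hFc : ∀ k, Continuous (F k)) (k : Fin d)
    {H : (Fin d → ℝ) × ℝ → ENNReal} (hH : Measurable H)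
    (hHk : ∀ v y u, H (Function.update v k y, u) = H (v, u)) :
    ∫⁻ v, H (v, rosenblatt G F (scm G f v) k) ∂(Measure.pi ν) =
      ∫⁻ v, (∫⁻ u in Set.Icc (0 : ℝ) 1, H (v, u)) ∂(Measure.pi ν) := by
  have hR : Measurable fun v => rosenblatt G F (scm G f v) k :=
    (measurable_pi_apply k).comp ((measurable_rosenblatt hFc).comp (measurable_scm hf))
  have hHR : Measurable fun v => H (v, rosenblatt G F (scm G f v) k) :=
    hH.comp (measurable_id.prodMk hR)
  -- After resampling, the inner integral runs over fresh k-th noise with the parents fixed, and the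
  -- probability integral transform applies to it.
  rw [← (measurePreserving_update ν k).lintegral_comp hHR,
    lintegral_prod (fun p : (Fin d → ℝ) × ℝ => H (Function.update p.1 k p.2,
      rosenblatt G F (scm G f (Function.update p.1 k p.2)) k))
      (hHR.comp (measurePreserving_update ν k).measurable).aemeasurable]
  refine lintegral_congr_ae ?_
  filter_upwards [hF k, hF.continuous_cdf hFc k] with v hv hvc
  have hfm : Measurable fun y => f k (slice G k (scm G f v), y) :=
    (hf k).comp measurable_prodMk_left
  have hp : IsProbabilityMeasure ((ν k).map fun y => f k (slice G k (scm G f v), y)) :=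
    Measure.isProbabilityMeasure_map hfm.aemeasurable
  have hHv : Measurable fun u => H (v, u) := hH.comp measurable_prodMk_left
  have hHc : Measurable fun y =>
      H (v, cdf ((ν k).map fun y => f k (slice G k (scm G f v), y)) y) :=
    hHv.comp hvc.measurable
  rw [← map_cdf_eq_uniform _ hvc, lintegral_map hHv hvc.measurable,
    lintegral_map hHc hfm]
  refine lintegral_congr fun y => ?_
  simp only [hHk, rosenblatt_scm_update hG, hv]

/-- Coordinates of the transform below k do not involve the k-th noise. Integrating out the factor
of largest index first therefore splits off one uniform factor at a time. -/
lemma map_rosenblatt (hG : IsSortedDAG G) (hf : ∀ i, Measurable (f i))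
    (hF : IsSCMCondCDF ν f F) (hFc : ∀ k, Continuous (F k)) :
    (Measure.pi ν).map (fun v => rosenblatt G F (scm G f v)) = unifCube d := by
  have hm : Measurable fun v => rosenblatt G F (scm G f v) :=
    (measurable_rosenblatt hFc).comp (measurable_scm hf)
  rw [unifCube_eq_pi]
  refine (Measure.pi_eq fun s hs => ?_).symm
  have key : ∀ A : Finset (Fin d),
      ∫⁻ v, ∏ i ∈ A, (s i).indicator 1 (rosenblatt G F (scm G f v) i) ∂(Measure.pi ν) =
        ∏ i ∈ A, volume.restrict (Set.Icc (0 : ℝ) 1) (s i) := by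
    intro A
    induction A using Finset.induction_on_max with
    | empty => simp
    | insert k A hA ih =>
      have hk : k ∉ A := fun h => lt_irrefl _ (hA k h)
      simp only [Finset.prod_insert hk]
      have hprod : Measurable fun v =>
          ∏ i ∈ A, (s i).indicator (1 : ℝ → ENNReal) (rosenblatt G F (scm G f v) i) :=
        Finset.measurable_prod _ fun i _ =>
          (measurable_one.indicator (hs i)).comp ((measurable_pi_apply i).comp hm)
      rw [lintegral_rosenblatt hG hf hF hFc k (H := fun p => (s k).indicator 1 p.2 *
        ∏ i ∈ A, (s i).indicator (1 : ℝ → ENNReal) (rosenblatt G F (scm G f p.1) i))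
        (((measurable_one.indicator (hs k)).comp measurable_snd).mul
          (hprod.comp measurable_fst))]
      · have h1 : ∀ v : Fin d → ℝ, ∫⁻ u in Set.Icc (0 : ℝ) 1, (s k).indicator 1 u *
            ∏ i ∈ A, (s i).indicator (1 : ℝ → ENNReal) (rosenblatt G F (scm G f v) i) =
            volume.restrict (Set.Icc (0 : ℝ) 1) (s k) *
            ∏ i ∈ A, (s i).indicator (1 : ℝ → ENNReal) (rosenblatt G F (scm G f v) i) :=
          fun v => by
            rw [lintegral_mul_const _ (measurable_one.indicator (hs k)),
              lintegral_indicator_one (hs k)]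
        simp only [h1]
        rw [lintegral_const_mul _ hprod, ih]
      · intro v y u
        congr 1
        refine Finset.prod_congr rfl fun i hi => ?_
        congr 1
        rw [rosenblatt, rosenblatt, scm_update_of_lt hG f v (hA i hi),
          slice_congr_of_lt hG fun j hj => scm_update_of_lt hG f v (hj.trans (hA i hi)) y]
  rw [Measure.map_apply hm (MeasurableSet.univ_pi hs), ← key Finset.univ,
    ← lintegral_indicator_one (hm (MeasurableSet.univ_pi hs))]
  refine lintegral_congr fun v => ?_
  by_cases h : ∀ i, rosenblatt G F (scm G f v) i ∈ s i
  · rw [Set.indicator_of_mem (by simpa using h)]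
    simp [h]
  · rw [Set.indicator_of_notMem (by simpa using h)]
    push Not at h
    obtain ⟨i, hi⟩ := h
    rw [Finset.prod_eq_zero (Finset.mem_univ i) (by simp [hi])]

/-- Almost surely, the conditional distribution functions are strictly smaller to the left of the
realised value. -/
lemma ae_rosenblatt (hG : IsSortedDAG G) (hf : ∀ i, Measurable (f i))
    (hF : IsSCMCondCDF ν f F) (hFc : ∀ k, Continuous (F k)) :
    ∀ᵐ v ∂(Measure.pi ν), ∀ k,
      (∀ t < scm G f v k, F k (t, slice G k (scm G f v)) < rosenblatt G F (scm G f v) k) ∧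
      (∀ t ≥ scm G f v k, rosenblatt G F (scm G f v) k ≤ F k (t, slice G k (scm G f v))) ∧
      ∀ t, F k (t, slice G k (scm G f v)) ∈ Set.Icc 0 1 := by
  rw [ae_all_iff]
  intro k
  have hm := measurable_scm hf
  have hmk : Measurable fun v => scm G f v k := (measurable_pi_apply k).comp hm
  have hsl : Measurable fun v => slice G k (scm G f v) := (measurable_slice k).comp hm
  have hR : Measurable fun v => rosenblatt G F (scm G f v) k :=
    (measurable_pi_apply k).comp ((measurable_rosenblatt hFc).comp hm)
  -- Restricting to rational q makes the event measurable, so that it can be transported through the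
  -- resampling map.
  have hq : ∀ᵐ v ∂(Measure.pi ν), ∀ q : ℚ, (q : ℝ) < scm G f v k →
      F k (q, slice G k (scm G f v)) < rosenblatt G F (scm G f v) k := by
    rw [← (measurePreserving_update ν k).map_eq]
    have hms : MeasurableSet {v : Fin d → ℝ | ∀ q : ℚ, (q : ℝ) < scm G f v k →
        F k (q, slice G k (scm G f v)) < rosenblatt G F (scm G f v) k} := by
      rw [Set.ofPred_forall]
      refine MeasurableSet.iInter fun q => MeasurableSet.imp ?_ ?_
      · exact measurableSet_lt measurable_const hmk
      · exact measurableSet_lt ((hFc k).measurable.comp (measurable_const.prodMk hsl)) hR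
    rw [ae_map_iff (measurePreserving_update ν k).aemeasurable hms,
      Measure.ae_prod_iff_ae_ae (p := fun x : (Fin d → ℝ) × ℝ => ∀ q : ℚ,
        (q : ℝ) < scm G f (Function.update x.1 k x.2) k →
          F k (q, slice G k (scm G f (Function.update x.1 k x.2))) <
            rosenblatt G F (scm G f (Function.update x.1 k x.2)) k)
        ((measurePreserving_update ν k).measurable hms)]
    filter_upwards [hF k, hF.continuous_cdf hFc k] with v hv hvc
    have hfm : Measurable fun y => f k (slice G k (scm G f v), y) :=
      (hf k).comp measurable_prodMk_left
    have hp : IsProbabilityMeasure ((ν k).map fun y => f k (slice G k (scm G f v), y)) :=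
      Measure.isProbabilityMeasure_map hfm.aemeasurable
    filter_upwards [ae_of_ae_map hfm.aemeasurable (ae_cdf_lt _ hvc)] with y hy q hqy
    rw [scm_apply hG, slice_scm_update hG, Function.update_self] at hqy
    rw [rosenblatt_scm_update hG, slice_scm_update hG, hv, hv]
    exact hy q hqy
  filter_upwards [hF k, hq] with v hv hvq
  refine ⟨fun t ht => ?_, fun t ht => ?_, fun t => ?_⟩
  · obtain ⟨q, hq1, hq2⟩ := exists_rat_btwn ht
    refine lt_of_le_of_lt ?_ (hvq q hq2)
    rw [hv, hv]
    exact monotone_cdf _ hq1.le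
  · rw [rosenblatt, hv, hv]
    exact monotone_cdf _ ht
  · rw [hv]
    exact ⟨cdf_nonneg _ _, cdf_le_one _ _⟩

end

section

/-! ### Monotone networks -/

/-- The projection of the real line to `[-1, 1]`. -/
def clampUnit (x : ℝ) : ℝ := max (-1) (min 1 x)

/-- The linear part makes the activation strictly increasing for α > 0; the clamp is the soft step
that remains as α tends to 0. -/
lemma rho_eq (α x : ℝ) : rho α x = α / 2 * x + (1 - α / 2) * clampUnit x := by
  unfold rho leakyReLU clampUnit
  rcases le_total x (-1) with h | h
  · rw [min_eq_right (by linarith), max_eq_left h, if_pos (by linarith : 0 ≤ 1 - x)]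
    split_ifs with h1
    · obtain rfl : x = -1 := by linarith
      ring
    · ring
  rcases le_total x 1 with h' | h'
  · rw [min_eq_right h', max_eq_right h, if_pos (by linarith), if_pos (by linarith)]
    ring
  · rw [min_eq_left h', max_eq_right (by linarith), if_pos (by linarith : 0 ≤ 1 + x)]
    split_ifs with h1
    · obtain rfl : x = 1 := by linarith
      ring
    · ring

lemma monotone_clampUnit : Monotone clampUnit := fun _ _ h =>
  max_le_max le_rfl (min_le_min le_rfl h)

lemma abs_clampUnit_le_one (x : ℝ) : |clampUnit x| ≤ 1 :=
  abs_le.2 ⟨le_max_left _ _, max_le (by norm_num) (min_le_left _ _)⟩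

lemma abs_clampUnit_sub_le (x y : ℝ) : |clampUnit x - clampUnit y| ≤ |x - y| :=
  (abs_max_sub_max_le_max _ _ _ _).trans <| by
    rw [sub_self, abs_zero, max_eq_right (abs_nonneg _)]
    refine (abs_min_sub_min_le_max _ _ _ _).trans ?_
    rw [sub_self, abs_zero, max_eq_right (abs_nonneg _)]

lemma clampUnit_of_one_le {x : ℝ} (h : 1 ≤ x) : clampUnit x = 1 := by
  rw [clampUnit, min_eq_left h, max_eq_right (by norm_num)]

lemma clampUnit_of_le_neg_one {x : ℝ} (h : x ≤ -1) : clampUnit x = -1 := by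
  rw [clampUnit, min_eq_right (by linarith), max_eq_left h]

lemma abs_clampUnit_le (x : ℝ) : |clampUnit x| ≤ |x| := by
  simpa [clampUnit] using abs_clampUnit_sub_le x 0

lemma abs_rho_sub_clampUnit_le {α : ℝ} (hα : 0 ≤ α) (x : ℝ) :
    |rho α x - clampUnit x| ≤ α * |x| := by
  have h : rho α x - clampUnit x = α / 2 * (x - clampUnit x) := by rw [rho_eq]; ring
  rw [h, abs_mul, abs_of_nonneg (by positivity : 0 ≤ α / 2)]
  have h1 := abs_sub x (clampUnit x)
  have h2 := abs_clampUnit_le x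
  calc α / 2 * |x - clampUnit x| ≤ α / 2 * (|x| + |x|) := by gcongr; linarith
    _ = α * |x| := by ring

lemma abs_rho_le {α : ℝ} (hα : α ∈ Set.Ioo (0 : ℝ) 1) (x : ℝ) : |rho α x| ≤ |x| := by
  rw [rho_eq]
  refine (abs_add_le _ _).trans ?_
  rw [abs_mul, abs_mul, abs_of_nonneg (by linarith [hα.1] : 0 ≤ α / 2),
    abs_of_nonneg (by linarith [hα.2] : 0 ≤ 1 - α / 2)]
  have h := mul_le_mul_of_nonneg_left (abs_clampUnit_le x)
    (by linarith [hα.2] : 0 ≤ 1 - α / 2)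
  linarith

lemma le_rho_sub {α : ℝ} (hα : α ∈ Set.Ioo (0 : ℝ) 1) {x y : ℝ} (h : x ≤ y) :
    α / 2 * (y - x) ≤ rho α y - rho α x := by
  have h1 := mul_nonneg (by linarith [hα.2] : 0 ≤ 1 - α / 2)
    (sub_nonneg.2 (monotone_clampUnit h))
  rw [rho_eq, rho_eq]
  linarith

lemma measurable_rho (α : ℝ) : Measurable (rho α) := by
  have : Continuous fun x => α / 2 * x + (1 - α / 2) * clampUnit x := by
    unfold clampUnit
    fun_prop
  rw [funext (rho_eq α)]
  exact this.measurable

/-- The linear part of each neuron contributes a positive slope, and there is at least one neuron.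
This expansion yields both injectivity and control of null sets. -/
lemma exists_le_incrMLP_sub {α : ℝ} (hα : α ∈ Set.Ioo (0 : ℝ) 1) {n : ℕ} (hn : 0 < n)
    {θ : RawParam n} (hθ : θ ∈ Theta n) :
    ∃ c > 0, ∀ x y, x ≤ y → c * (y - x) ≤ incrMLP α y θ - incrMLP α x θ := by
  refine ⟨∑ i, θ.2.2.1 i * (α / 2 * θ.1 i), ?_, fun x y hxy => ?_⟩
  · have : Nonempty (Fin n) := ⟨⟨0, hn⟩⟩
    exact Finset.sum_pos (fun i _ => mul_pos (hθ.2 i)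
      (mul_pos (half_pos hα.1) (hθ.1 i))) Finset.univ_nonempty
  · unfold incrMLP
    rw [add_sub_add_right_eq_sub, ← Finset.sum_sub_distrib, Finset.sum_mul]
    refine Finset.sum_le_sum fun i _ => ?_
    rw [← mul_sub, mul_assoc]
    refine mul_le_mul_of_nonneg_left ?_ (hθ.2 i).le
    have := le_rho_sub hα (x := θ.1 i * x + θ.2.1 i) (y := θ.1 i * y + θ.2.1 i)
      (by have := mul_le_mul_of_nonneg_left hxy (hθ.1 i).le; linarith)
    refine le_of_eq_of_le ?_ this
    ring

lemma abs_incrMLP_le {α : ℝ} (hα : α ∈ Set.Ioo (0 : ℝ) 1) {n : ℕ} (θ : RawParam n) {x : ℝ}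
    (hx : x ∈ Set.Icc (0 : ℝ) 1) :
    |incrMLP α x θ| ≤ ∑ i, |θ.2.2.1 i| * (|θ.1 i| + |θ.2.1 i|) + |θ.2.2.2| := by
  unfold incrMLP
  refine (abs_add_le _ _).trans (add_le_add_left ((Finset.abs_sum_le_sum_abs _ _).trans
    (Finset.sum_le_sum fun i _ => ?_)) _)
  rw [abs_mul]
  refine mul_le_mul_of_nonneg_left ((abs_rho_le hα _).trans ((abs_add_le _ _).trans ?_))
    (abs_nonneg _)
  refine add_le_add_left ?_ _
  rw [abs_mul]
  exact mul_le_of_le_one_right (abs_nonneg _) (abs_le.2 ⟨by linarith [hx.1], hx.2⟩)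

/-! ### Layers of normalizing flows -/

/-- The structural equation of a hypercoupling layer at the coordinate `k`. -/
def IsLayer {d : ℕ} (G : Digraph (Fin d)) (α : ℝ) (σ : ℝ → ℝ) (k : Fin d)
    (t : (parents G k → ℝ) × ℝ → ℝ) : Prop :=
  ∃ n : ℕ, 0 < n ∧ ∃ θ : (parents G k → ℝ) → RawParam n,
    IsMLP σ θ ∧ (∀ z, θ z ∈ Theta n) ∧ t = fun p => incrMLP α p.2 (θ p.1)

variable {d : ℕ} {G : Digraph (Fin d)} {α : ℝ} {σ : ℝ → ℝ}

lemma isGCausalNF_scm {t : ∀ k : Fin d, (parents G k → ℝ) × ℝ → ℝ}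
    (ht : ∀ k, IsLayer G α σ k (t k)) : IsGCausalNF G α σ (scm G t) := by
  refine ⟨fun k => scmStep G t k, fun k => ?_, fun x => rfl⟩
  obtain ⟨n, hn, θ, h1, h2, h3⟩ := ht k
  exact ⟨n, hn, θ, h1, h2, fun x => by simp only [scmStep, h3]⟩

lemma exists_isLayer (G : Digraph (Fin d)) (α : ℝ) (σ : ℝ → ℝ) (k : Fin d) :
    ∃ t, IsLayer G α σ k t :=
  ⟨_, 1, one_pos, fun _ => (1, 0, 1, 0), IsMLP.const σ _, fun _ => by simp [Theta], rfl⟩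

section Params

variable {ι : Type} [Fintype ι] {n : ℕ} {θ : (ι → ℝ) → RawParam n}

lemma IsMLP.weightIn (h : IsMLP σ θ) (i : Fin n) : IsMLP σ fun z => (θ z).1 i :=
  h.map (LinearMap.proj i ∘ₗ LinearMap.fst ℝ _ _)

lemma IsMLP.biasIn (h : IsMLP σ θ) (i : Fin n) : IsMLP σ fun z => (θ z).2.1 i :=
  h.map (LinearMap.proj i ∘ₗ LinearMap.fst ℝ _ _ ∘ₗ LinearMap.snd ℝ _ _)

lemma IsMLP.weightOut (h : IsMLP σ θ) (i : Fin n) : IsMLP σ fun z => (θ z).2.2.1 i :=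
  h.map (LinearMap.proj i ∘ₗ LinearMap.fst ℝ _ _ ∘ₗ LinearMap.snd ℝ _ _ ∘ₗ
    LinearMap.snd ℝ _ _)

lemma IsMLP.biasOut (h : IsMLP σ θ) : IsMLP σ fun z => (θ z).2.2.2 :=
  h.map (LinearMap.snd ℝ _ _ ∘ₗ LinearMap.snd ℝ _ _ ∘ₗ LinearMap.snd ℝ _ _)

end Params

lemma IsLayer.measurable (hσ : IsMLPActivation σ) {k : Fin d} {t : (parents G k → ℝ) × ℝ → ℝ}
    (h : IsLayer G α σ k t) : Measurable t := by
  obtain ⟨n, -, θ, hθ, -, rfl⟩ := h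
  unfold incrMLP
  refine (Finset.measurable_sum _ fun i _ => ?_).add
    ((hθ.biasOut.measurable hσ).comp measurable_fst)
  refine (((hθ.weightOut i).measurable hσ).comp measurable_fst).mul ?_
  refine (measurable_rho α).comp (Measurable.add ?_ ?_)
  · exact (((hθ.weightIn i).measurable hσ).comp measurable_fst).mul measurable_snd
  · exact ((hθ.biasIn i).measurable hσ).comp measurable_fst

lemma IsLayer.strictMono (hα : α ∈ Set.Ioo (0 : ℝ) 1) {k : Fin d}
    {t : (parents G k → ℝ) × ℝ → ℝ} (h : IsLayer G α σ k t) (z : parents G k → ℝ) :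
    StrictMono fun y => t (z, y) := by
  obtain ⟨n, hn, θ, hθ, hθ', rfl⟩ := h
  obtain ⟨c, hc, h⟩ := exists_le_incrMLP_sub hα hn (hθ' z)
  intro x y hxy
  have := h x y hxy.le
  have := mul_pos hc (sub_pos.2 hxy)
  simp only
  linarith

/-- The map is antilipschitz, so preimages increase one-dimensional Hausdorff measure, which is
Lebesgue measure on the line, by at most a constant factor. -/
lemma IsLayer.volume_preimage_eq_zero (hα : α ∈ Set.Ioo (0 : ℝ) 1) {k : Fin d}
    {t : (parents G k → ℝ) × ℝ → ℝ} (h : IsLayer G α σ k t) (z : parents G k → ℝ) {s : Set ℝ}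
    (hs : volume s = 0) : volume ((fun y => t (z, y)) ⁻¹' s) = 0 := by
  obtain ⟨n, hn, θ, hθ, hθ', rfl⟩ := h
  obtain ⟨c, hc, h⟩ := exists_le_incrMLP_sub hα hn (hθ' z)
  have hanti : AntilipschitzWith (Real.toNNReal c⁻¹) fun y => incrMLP α y (θ z) := by
    refine AntilipschitzWith.of_le_mul_dist fun x y => ?_
    rw [Real.coe_toNNReal _ (inv_nonneg.2 hc.le), Real.dist_eq, Real.dist_eq,
      inv_mul_eq_div, le_div_iff₀ hc, mul_comm]
    rcases le_total x y with hxy | hxy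
    · rw [abs_sub_comm x y, abs_sub_comm (incrMLP α x (θ z)), abs_of_nonneg (sub_nonneg.2 hxy)]
      exact (h x y hxy).trans (le_abs_self _)
    · rw [abs_of_nonneg (sub_nonneg.2 hxy)]
      exact (h y x hxy).trans (le_abs_self _)
  have h1 := hanti.hausdorffMeasure_preimage_le zero_le_one s
  rw [hausdorffMeasure_real, hs, mul_zero] at h1
  exact le_antisymm h1 zero_le

lemma IsLayer.ae_bound (hσ : IsMLPActivation σ) (hα : α ∈ Set.Ioo (0 : ℝ) 1) {k : Fin d}
    {t : (parents G k → ℝ) × ℝ → ℝ} (h : IsLayer G α σ k t) {m : Measure (parents G k → ℝ)}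
    (hm : m ≪ volume) {R : ℝ} (hR : ∀ᵐ z ∂m, ∀ i, |z i| ≤ R) :
    ∃ C, ∀ᵐ z ∂m, ∀ x ∈ Set.Icc (0 : ℝ) 1, |t (z, x)| ≤ C := by
  obtain ⟨n, hn, θ, hθ, hθ', rfl⟩ := h
  choose C₁ h₁ using fun i => (hθ.weightIn i).ae_bound hσ hm hR
  choose C₂ h₂ using fun i => (hθ.biasIn i).ae_bound hσ hm hR
  choose C₃ h₃ using fun i => (hθ.weightOut i).ae_bound hσ hm hR
  obtain ⟨C₄, h₄⟩ := hθ.biasOut.ae_bound hσ hm hR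
  refine ⟨∑ i, C₃ i * (C₁ i + C₂ i) + C₄, ?_⟩
  filter_upwards [ae_all_iff.2 h₁, ae_all_iff.2 h₂, ae_all_iff.2 h₃, h₄] with z z1 z2 z3 z4 x hx
  refine (abs_incrMLP_le hα (θ z) hx).trans (add_le_add (Finset.sum_le_sum fun i _ => ?_) z4)
  exact mul_le_mul (z3 i) (add_le_add (z1 i) (z2 i)) (by positivity)
    ((abs_nonneg _).trans (z3 i))

/-- Fubini along the lines parallel to the k-th axis: on each of them the step is a map of the line
with fixed parents, which pulls null sets back to null sets. -/
lemma quasiMeasurePreserving_scmStep (hG : IsSortedDAG G) (hσ : IsMLPActivation σ)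
    (hα : α ∈ Set.Ioo (0 : ℝ) 1) {t : ∀ k : Fin d, (parents G k → ℝ) × ℝ → ℝ}
    (ht : ∀ k, IsLayer G α σ k (t k)) (k : Fin d) :
    Measure.QuasiMeasurePreserving (scmStep G t k) := by
  have hm : Measurable (scmStep G t k) := measurable_scmStep (fun k => (ht k).measurable hσ) k
  refine ⟨hm, Measure.AbsolutelyContinuous.mk fun N hN hN0 => ?_⟩
  rw [Measure.map_apply hm hN]
  have hvol : ∀ S : Set (Fin d → ℝ), MeasurableSet S → volume S =
      ∫⁻ y : ↥(Finset.univ.erase k) → ℝ,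
        volume {x | Function.update (Function.updateFinset (0 : Fin d → ℝ) _ y) k x ∈ S} := by
    intro S hS
    have hi : Measurable (S.indicator (1 : (Fin d → ℝ) → ENNReal)) := measurable_one.indicator hS
    rw [← lintegral_indicator_one hS, volume_pi, lintegral_eq_lmarginal_univ (0 : Fin d → ℝ),
      lmarginal_erase' _ hi (Finset.mem_univ k), lmarginal]
    refine lintegral_congr fun y => ?_
    have hu : Measurable fun x : ℝ => Function.update
        (Function.updateFinset (0 : Fin d → ℝ) (Finset.univ.erase k) y) k x :=
      measurable_update _
    exact lintegral_indicator_one (hu hS)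
  have hmeas : ∀ S : Set (Fin d → ℝ), MeasurableSet S →
      Measurable fun y : ↥(Finset.univ.erase k) → ℝ =>
        volume {x | Function.update (Function.updateFinset (0 : Fin d → ℝ) _ y) k x ∈ S} := by
    intro S hS
    have hj : Measurable fun p : (↥(Finset.univ.erase k) → ℝ) × ℝ =>
        Function.update (Function.updateFinset (0 : Fin d → ℝ) _ p.1) k p.2 := by
      refine measurable_pi_lambda _ fun j => ?_
      by_cases h : j = k
      · subst h; simpa using measurable_snd
      · simp only [Function.update_of_ne h]
        have h1 : Measurable fun y : ↥(Finset.univ.erase k) → ℝ =>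
            Function.updateFinset (0 : Fin d → ℝ) (Finset.univ.erase k) y :=
          measurable_updateFinset
        exact (measurable_pi_apply j).comp (h1.comp measurable_fst)
    exact measurable_measure_prodMk_left (hj hS)
  rw [hvol N hN, lintegral_eq_zero_iff (hmeas N hN)] at hN0
  rw [hvol _ (hm hN), lintegral_eq_zero_iff (hmeas _ (hm hN))]
  filter_upwards [hN0] with y hy
  set x₀ := Function.updateFinset (0 : Fin d → ℝ) _ y
  have h1 : {x | Function.update x₀ k x ∈ scmStep G t k ⁻¹' N} =
      (fun x => t k (slice G k x₀, x)) ⁻¹' {x | Function.update x₀ k x ∈ N} := by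
    ext x
    simp only [Set.mem_ofPred_eq, Set.mem_preimage, scmStep, Function.update_self,
      Function.update_idem, slice_update hG]
  rw [h1]
  exact (ht k).volume_preimage_eq_zero hα _ hy

lemma quasiMeasurePreserving_scm (hG : IsSortedDAG G) (hσ : IsMLPActivation σ)
    (hα : α ∈ Set.Ioo (0 : ℝ) 1) {t : ∀ k : Fin d, (parents G k → ℝ) × ℝ → ℝ}
    (ht : ∀ k, IsLayer G α σ k (t k)) : Measure.QuasiMeasurePreserving (scm G t) := by
  have : ∀ l : List (Fin d), Measure.QuasiMeasurePreserving
      fun v : Fin d → ℝ => l.foldl (fun y k => scmStep G t k y) v := by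
    intro l
    induction l with
    | nil => exact Measure.QuasiMeasurePreserving.id _
    | cons k l ih => exact ih.comp (quasiMeasurePreserving_scmStep hG hσ hα ht k)
  exact this _

lemma quasiMeasurePreserving_slice (k : Fin d) :
    Measure.QuasiMeasurePreserving (slice G k) := by
  refine ⟨measurable_slice k, Measure.AbsolutelyContinuous.mk fun N hN hN0 => ?_⟩
  rw [Measure.map_apply (measurable_slice k) hN]
  have := (ae_comp_linearMap_mem_iff (μ := volume) (ν := volume)
    (L := LinearMap.funLeft ℝ ℝ (Subtype.val : parents G k → Fin d))
    (LinearMap.funLeft_surjective_of_injective ℝ ℝ _ Subtype.val_injective) hN.compl).2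
    (measure_eq_zero_iff_ae_notMem.1 hN0)
  exact measure_eq_zero_iff_ae_notMem.2 this

lemma map_slice_scm_absolutelyContinuous (hG : IsSortedDAG G) (hσ : IsMLPActivation σ)
    (hα : α ∈ Set.Ioo (0 : ℝ) 1) {t : ∀ k : Fin d, (parents G k → ℝ) × ℝ → ℝ}
    (ht : ∀ k, IsLayer G α σ k (t k)) (k : Fin d) :
    (unifCube d).map (fun u => slice G k (scm G t u)) ≪ volume :=
  (((quasiMeasurePreserving_slice k).comp (quasiMeasurePreserving_scm hG hσ hα ht)).mono_left
    Measure.absolutelyContinuous_restrict).absolutelyContinuous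

lemma ae_unifCube_mem (k : Fin d) : ∀ᵐ u ∂(unifCube d), u k ∈ Set.Icc (0 : ℝ) 1 := by
  filter_upwards [ae_restrict_mem (measurableSet_Icc (a := (0 : Fin d → ℝ)) (b := 1))] with u hu
  exact ⟨hu.1 k, hu.2 k⟩

/-- Induction along the order. As σ is only essentially bounded, the parameters of a layer are
bounded through the absolute continuity of the law of its parents. -/
lemma exists_ae_abs_scm_le (hG : IsSortedDAG G) (hσ : IsMLPActivation σ)
    (hα : α ∈ Set.Ioo (0 : ℝ) 1) {t : ∀ k : Fin d, (parents G k → ℝ) × ℝ → ℝ}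
    (ht : ∀ k, IsLayer G α σ k (t k)) :
    ∃ R, ∀ᵐ u ∂(unifCube d), ∀ k, |scm G t u k| ≤ R := by
  have hm : Measurable (scm G t) := measurable_scm fun k => (ht k).measurable hσ
  have h : ∀ k, ∃ R, ∀ᵐ u ∂(unifCube d), |scm G t u k| ≤ R := by
    intro k
    induction k using WellFoundedLT.induction with
    | ind k ih =>
      choose! R hR using ih
      have hsl : Measurable fun u => slice G k (scm G t u) := (measurable_slice k).comp hm
      have hbd : ∀ᵐ z ∂(unifCube d).map (fun u => slice G k (scm G t u)),
          ∀ i, |z i| ≤ ∑ j, |R j| := by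
        rw [ae_map_iff hsl.aemeasurable]
        · have h1 : ∀ i : parents G k, ∀ᵐ u ∂(unifCube d), |scm G t u i| ≤ R i := fun i =>
            hR i (hG _ _ (adj_of_mem_parents i))
          filter_upwards [ae_all_iff.2 h1] with u hu i
          exact (hu i).trans ((le_abs_self _).trans
            (Finset.single_le_sum (f := fun j => |R j|) (fun j _ => abs_nonneg _)
              (Finset.mem_univ _)))
        · rw [Set.ofPred_forall]
          exact MeasurableSet.iInter fun i =>
            measurableSet_le (measurable_pi_apply i).abs measurable_const
      obtain ⟨C, hC⟩ := (ht k).ae_bound hσ hα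
        (map_slice_scm_absolutelyContinuous hG hσ hα ht k) hbd
      refine ⟨C, ?_⟩
      filter_upwards [ae_of_ae_map hsl.aemeasurable hC, ae_unifCube_mem k] with u hu huk
      rw [scm_apply hG]
      exact hu _ huk
  choose R hR using h
  refine ⟨∑ j, |R j|, ?_⟩
  filter_upwards [ae_all_iff.2 hR] with u hu k
  exact (hu k).trans ((le_abs_self _).trans
    (Finset.single_le_sum (f := fun j => |R j|) (fun j _ => abs_nonneg _) (Finset.mem_univ _)))

lemma euclNorm_le_sum (x : Fin d → ℝ) : euclNorm x ≤ ∑ i, |x i| := by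
  rw [euclNorm, EuclideanSpace.norm_eq, Real.sqrt_le_left (by positivity)]
  simp only [Real.norm_eq_abs]
  exact Finset.sum_sq_le_sq_sum_of_nonneg fun i _ => abs_nonneg _

lemma continuous_euclNorm : Continuous (euclNorm : (Fin d → ℝ) → ℝ) :=
  continuous_norm.comp (PiLp.continuous_toLp 2 _)

lemma map_scm_mem_PG1 (hG : IsSortedDAG G) (hσ : IsMLPActivation σ)
    (hα : α ∈ Set.Ioo (0 : ℝ) 1) {t : ∀ k : Fin d, (parents G k → ℝ) × ℝ → ℝ}
    (ht : ∀ k, IsLayer G α σ k (t k)) : (unifCube d).map (scm G t) ∈ PG1 G := by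
  have htm := fun k => (ht k).measurable hσ
  have hm : Measurable (scm G t) := measurable_scm htm
  refine ⟨Measure.isProbabilityMeasure_map hm.aemeasurable, ?_, ?_⟩
  · rw [unifCube_eq_pi]
    exact isGCompatible_map_scm hG htm _
  · rw [integrable_map_measure continuous_euclNorm.aestronglyMeasurable hm.aemeasurable]
    obtain ⟨R, hR⟩ := exists_ae_abs_scm_le hG hσ hα ht
    refine Integrable.of_bound (continuous_euclNorm.measurable.comp hm).aestronglyMeasurable
      (∑ _ : Fin d, R) ?_
    filter_upwards [hR] with u hu
    rw [Function.comp_apply, Real.norm_of_nonneg (show 0 ≤ euclNorm _ from norm_nonneg _)]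
    exact (euclNorm_le_sum _).trans (Finset.sum_le_sum fun i _ => hu i)

end

section

/-! ### Deterministic bicausal couplings -/

/-- Lusin–Souslin: an injective Borel map on a Borel set is a measurable embedding, so its inverse
extends measurably. -/
lemma exists_measurable_leftInvOn {A B : Type*} [MeasurableSpace A] [StandardBorelSpace A]
    [Nonempty A] [MeasurableSpace B] [MeasurableSpace.CountablySeparated B] {φ : A → B}
    (hφ : Measurable φ) {S : Set A} (hS : MeasurableSet S) (hinj : Set.InjOn φ S) :
    ∃ ψ : B → A, Measurable ψ ∧ ∀ a ∈ S, ψ (φ a) = a := by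
  have hstd : StandardBorelSpace S := hS.standardBorel
  have hemb : MeasurableEmbedding (S.domRestrict φ) :=
    (hφ.comp measurable_subtype_coe).measurableEmbedding hinj.injective
  obtain ⟨ψ, hψ, h⟩ := hemb.exists_measurable_extend (g := ((↑) : S → A))
    measurable_subtype_coe (fun _ => inferInstance)
  exact ⟨ψ, hψ, fun a ha => congrFun h ⟨a, ha⟩⟩

variable {d : ℕ} {G : Digraph (Fin d)}

/-- No extra randomness is used: constant noises are independent of each other and of everything
else. -/
lemma isGCausal_map {ν : Fin d → Measure ℝ} [∀ i, IsProbabilityMeasure (ν i)]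
    {X X' : (Fin d → ℝ) → (Fin d → ℝ)} (hX : Measurable X) (hX' : Measurable X')
    {g : ∀ i : Fin d, ℝ × (parents G i → ℝ) × (parents G i → ℝ) → ℝ}
    (hg : ∀ i, Measurable (g i))
    (h : ∀ i, ∀ᵐ v ∂(Measure.pi ν), X' v i = g i (X v i, slice G i (X v), slice G i (X' v))) :
    IsGCausal G ((Measure.pi ν).map fun v => (X v, X' v)) := by
  refine ⟨Fin d → ℝ, inferInstance, Measure.pi ν, X, X', fun _ _ => 0,
    fun i p => g i (p.1, p.2.1, p.2.2.1), inferInstance, hX, hX', fun _ => measurable_const,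
    fun i => (hg i).comp (by fun_prop), rfl, ?_, indepFun_const_right _ _, h⟩
  exact (iIndepFun_pi (μ := ν) (X := fun _ => id) fun _ => aemeasurable_id).comp
    (fun _ _ => (0 : ℝ)) fun _ => measurable_const

variable {ν : Fin d → Measure ℝ} [∀ i, IsProbabilityMeasure (ν i)]
  {f : ∀ i : Fin d, (parents G i → ℝ) × ℝ → ℝ}
  {F : ∀ k : Fin d, ℝ × (parents G k → ℝ) → ℝ}

lemma map_mem_bicausalCouplings (hG : IsSortedDAG G) (hf : ∀ i, Measurable (f i))
    (hF : IsSCMCondCDF ν f F) (hFc : ∀ k, Continuous (F k))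
    {t : ∀ k : Fin d, (parents G k → ℝ) × ℝ → ℝ} (ht : ∀ k, Measurable (t k))
    (hmono : ∀ k z, StrictMono fun y => t k (z, y)) :
    (Measure.pi ν).map (fun v => (scm G f v, scm G t (rosenblatt G F (scm G f v)))) ∈
      bicausalCouplings G ((Measure.pi ν).map (scm G f)) ((unifCube d).map (scm G t)) := by
  have hX := measurable_scm hf
  have hT := measurable_scm ht
  have hW : Measurable fun v => rosenblatt G F (scm G f v) := (measurable_rosenblatt hFc).comp hX
  have hY : Measurable fun v => scm G t (rosenblatt G F (scm G f v)) := hT.comp hW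
  refine ⟨?_, ?_, ?_, ?_⟩
  · rw [Measure.map_map measurable_fst (hX.prodMk hY)]
    rfl
  · rw [Measure.map_map measurable_snd (hX.prodMk hY), ← map_rosenblatt hG hf hF hFc,
      Measure.map_map hT hW]
    rfl
  · refine isGCausal_map hX hY (g := fun i p => t i (p.2.2, F i (p.1, p.2.1)))
      (fun i => (ht i).comp ?_) fun i => ae_of_all _ fun v => scm_apply hG t _ i
    exact (by fun_prop : Measurable fun p : ℝ × (parents G i → ℝ) × (parents G i → ℝ) =>
      p.2.2).prodMk ((hFc i).measurable.comp (by fun_prop))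
  · rw [Measure.map_map measurable_swap (hX.prodMk hY)]
    have hinv : ∀ i, ∃ ψ : ℝ × (parents G i → ℝ) × (parents G i → ℝ) → ℝ, Measurable ψ ∧
        ∀ᵐ v ∂(Measure.pi ν), scm G f v i = ψ (scm G t (rosenblatt G F (scm G f v)) i,
          slice G i (scm G t (rosenblatt G F (scm G f v))), slice G i (scm G f v)) := by
      intro i
      -- The slots hold X_i, the generated parents and the true parents. Testing against rationals
      -- keeps the set Borel, yet it suffices for strict monotonicity of `F i` between any two of
      -- its points with the same parents.
      let S : Set (ℝ × (parents G i → ℝ) × (parents G i → ℝ)) :=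
        {p | ∀ q : ℚ, (p.1 < q → F i (p.1, p.2.2) ≤ F i (q, p.2.2)) ∧
          (q < p.1 → F i (q, p.2.2) < F i (p.1, p.2.2))}
      have hF1 : Measurable fun p : ℝ × (parents G i → ℝ) × (parents G i → ℝ) =>
          F i (p.1, p.2.2) := (hFc i).measurable.comp (by fun_prop)
      have hF2 : ∀ q : ℚ, Measurable fun p : ℝ × (parents G i → ℝ) × (parents G i → ℝ) =>
          F i (q, p.2.2) := fun q => (hFc i).measurable.comp (by fun_prop)
      have hS : MeasurableSet S := by
        simp only [S, Set.ofPred_forall, Set.ofPred_and]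
        refine MeasurableSet.iInter fun q => MeasurableSet.inter ?_ ?_
        · exact (measurableSet_lt measurable_fst measurable_const).imp
            (measurableSet_le hF1 (hF2 q))
        · exact (measurableSet_lt measurable_const measurable_fst).imp
            (measurableSet_lt (hF2 q) hF1)
      have hlt : ∀ x x' z z', (x, z, z') ∈ S → (x', z, z') ∈ S → x < x' →
          F i (x, z') < F i (x', z') := by
        intro x x' z z' h h' hxx
        obtain ⟨q, h1, h2⟩ := exists_rat_btwn hxx
        exact ((h q).1 h1).trans_lt ((h' q).2 h2)
      have hφ : Measurable fun p : ℝ × (parents G i → ℝ) × (parents G i → ℝ) =>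
          (t i (p.2.1, F i (p.1, p.2.2)), p.2) :=
        ((ht i).comp ((by fun_prop : Measurable fun p :
          ℝ × (parents G i → ℝ) × (parents G i → ℝ) => p.2.1).prodMk hF1)).prodMk measurable_snd
      have hinj : Set.InjOn (fun p : ℝ × (parents G i → ℝ) × (parents G i → ℝ) =>
          (t i (p.2.1, F i (p.1, p.2.2)), p.2)) S := by
        rintro ⟨x, z, z'⟩ h ⟨x', w, w'⟩ h' heq
        simp only [Prod.mk.injEq] at heq
        obtain ⟨h1, rfl, rfl⟩ := heq
        have h2 := (hmono i z).injective h1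
        rcases lt_trichotomy x x' with hxx | rfl | hxx
        · exact absurd h2 (hlt x x' z z' h h' hxx).ne
        · rfl
        · exact absurd h2 (hlt x' x z z' h' h hxx).ne'
      obtain ⟨ψ, hψ, hψ'⟩ := exists_measurable_leftInvOn hφ hS hinj
      refine ⟨fun p => (ψ p).1, measurable_fst.comp hψ, ?_⟩
      filter_upwards [ae_rosenblatt hG hf hF hFc] with v hv
      obtain ⟨h1, h2, -⟩ := hv i
      have hmem : (scm G f v i, slice G i (scm G t (rosenblatt G F (scm G f v))),
          slice G i (scm G f v)) ∈ S := fun q => ⟨fun hq => h2 q hq.le, h1 q⟩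
      have h3 := hψ' _ hmem
      rw [scm_apply hG t (rosenblatt G F (scm G f v)) i]
      exact (congrArg Prod.fst h3).symm
    choose ψ hψ1 hψ2 using hinv
    exact isGCausal_map hY hX hψ1 hψ2

/-- The distance is bounded by the mean error of the flow, driven by the Rosenblatt transform. -/
lemma WG_le_sum (hG : IsSortedDAG G) (hf : ∀ i, Measurable (f i))
    (hF : IsSCMCondCDF ν f F) (hFc : ∀ k, Continuous (F k))
    {t : ∀ k : Fin d, (parents G k → ℝ) × ℝ → ℝ} (ht : ∀ k, Measurable (t k))
    (hmono : ∀ k z, StrictMono fun y => t k (z, y)) :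
    WG G ((Measure.pi ν).map (scm G f)) ((unifCube d).map (scm G t)) ≤
      ∑ k, ∫⁻ v, ENNReal.ofReal |scm G f v k - scm G t (rosenblatt G F (scm G f v)) k|
        ∂(Measure.pi ν) := by
  have hX := measurable_scm hf
  have hY : Measurable fun v => scm G t (rosenblatt G F (scm G f v)) :=
    (measurable_scm ht).comp ((measurable_rosenblatt hFc).comp hX)
  refine (iInf₂_le _ (map_mem_bicausalCouplings hG hf hF hFc ht hmono)).trans ?_
  have hcost : Measurable fun p : (Fin d → ℝ) × (Fin d → ℝ) =>
      ENNReal.ofReal (euclNorm (p.1 - p.2)) :=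
    (continuous_euclNorm.measurable.comp (measurable_fst.sub measurable_snd)).ennreal_ofReal
  rw [lintegral_map hcost (hX.prodMk hY), ← lintegral_finsetSum _ fun k _ => ?_]
  · refine lintegral_mono fun v => ?_
    rw [← ENNReal.ofReal_sum_of_nonneg fun _ _ => abs_nonneg _]
    exact ENNReal.ofReal_le_ofReal (euclNorm_le_sum _)
  · exact (((measurable_pi_apply k).comp hX).sub
      ((measurable_pi_apply k).comp hY)).abs.ennreal_ofReal

end

section

/-! ### Bounds for means -/

/-- The measurable function `a` has mean at most `r`. -/
def MeanLE {Ω : Type*} [MeasurableSpace Ω] (P : Measure Ω) (a : Ω → ℝ) (r : ℝ) : Prop :=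
  Measurable a ∧ 0 ≤ r ∧ ∫⁻ v, ENNReal.ofReal (a v) ∂P ≤ ENNReal.ofReal r

namespace MeanLE

variable {Ω : Type*} [MeasurableSpace Ω] {P : Measure Ω} {a b : Ω → ℝ} {r s : ℝ}

lemma const [IsProbabilityMeasure P] (hr : 0 ≤ r) : MeanLE P (fun _ => r) r :=
  ⟨measurable_const, hr, by simp⟩

lemma add (ha : MeanLE P a r) (hb : MeanLE P b s) : MeanLE P (fun v => a v + b v) (r + s) := by
  refine ⟨ha.1.add hb.1, add_nonneg ha.2.1 hb.2.1, ?_⟩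
  rw [ENNReal.ofReal_add ha.2.1 hb.2.1]
  refine (lintegral_mono fun v => ENNReal.ofReal_add_le).trans ?_
  rw [lintegral_add_left ha.1.ennreal_ofReal]
  exact add_le_add ha.2.2 hb.2.2

lemma const_mul {c : ℝ} (hc : 0 ≤ c) (ha : MeanLE P a r) : MeanLE P (fun v => c * a v) (c * r) := by
  refine ⟨ha.1.const_mul c, mul_nonneg hc ha.2.1, ?_⟩
  simp only [ENNReal.ofReal_mul hc]
  rw [lintegral_const_mul _ ha.1.ennreal_ofReal]
  exact mul_le_mul_right ha.2.2 _

lemma sum {ι : Type*} [Fintype ι] {a : ι → Ω → ℝ} (h : ∀ i, MeanLE P (a i) r) :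
    MeanLE P (fun v => ∑ i, a i v) (Fintype.card ι * r) := by
  have key : ∀ A : Finset ι, MeanLE P (fun v => ∑ i ∈ A, a i v) (A.card * r) := by
    classical
    intro A
    induction A using Finset.induction_on with
    | empty => exact ⟨by simp, by simp, by simp⟩
    | insert i A hi ih =>
      simp only [Finset.sum_insert hi, Finset.card_insert_of_notMem hi]
      have := (h i).add ih
      convert this using 1
      push_cast
      ring
  exact key Finset.univ

lemma mono (ha : MeanLE P a r) (hb : Measurable b) (hrs : r ≤ s)
    (h : ∀ᵐ v ∂P, b v ≤ a v) : MeanLE P b s :=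
  ⟨hb, ha.2.1.trans hrs, (lintegral_mono_ae (h.mono fun _ hv => ENNReal.ofReal_le_ofReal hv)).trans
    (ha.2.2.trans (ENNReal.ofReal_le_ofReal hrs))⟩

end MeanLE

/-! ### Layers that approximate a staircase -/

/-- Exactly ⌈(x + M)/h⌉ grid points lie strictly below x, so the sum equals h⌈(x + M)/h⌉ - M. Jumps
from -1 to 1 match the clamped activation. -/
lemma abs_sub_staircase_le {N : ℕ} (hN : 0 < N) {M x : ℝ} (hM : 0 < M) (hx : |x| ≤ M) :
    |x - ∑ i : Fin N, 2 * M / N / 2 * (if -M + i * (2 * M / N) < x then 1 else -1)| ≤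
      2 * M / N := by
  have hN' : (0 : ℝ) < N := by exact_mod_cast hN
  set h := 2 * M / N with hh
  have hpos : 0 < h := by positivity
  have hNh : N * h = 2 * M := by rw [hh]; field_simp
  set s := (x + M) / h with hs
  have hs0 : 0 ≤ s := div_nonneg (by linarith [(abs_le.1 hx).1]) hpos.le
  have hsN : s ≤ N := by
    rw [hs, div_le_iff₀ hpos, hNh]
    linarith [(abs_le.1 hx).2]
  have hsh : s * h = x + M := by rw [hs]; field_simp
  have hcond : ∀ i : ℕ, (-M + i * h < x ↔ i < ⌈s⌉₊) := fun i => by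
    rw [Nat.lt_ceil, hs, lt_div_iff₀ hpos]
    constructor <;> intro _ <;> linarith
  have hcount : ∑ i : Fin N, h / 2 * (if -M + i * h < x then (1 : ℝ) else -1) =
      h * ⌈s⌉₊ - M := by
    have h1 : ∀ i : Fin N, h / 2 * (if -M + i * h < x then (1 : ℝ) else -1) =
        h * (if (i : ℕ) < ⌈s⌉₊ then (1 : ℝ) else 0) - h / 2 := fun i => by
      simp only [hcond]
      split_ifs <;> ring
    simp only [h1]
    rw [Finset.sum_sub_distrib, ← Finset.mul_sum,
      Fin.sum_univ_eq_sum_range (fun i => if i < ⌈s⌉₊ then (1 : ℝ) else 0) N, Finset.sum_boole]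
    have h2 : (Finset.range N).filter (fun i => i < ⌈s⌉₊) = Finset.range ⌈s⌉₊ := by
      ext i
      simp only [Finset.mem_filter, Finset.mem_range, and_iff_right_iff_imp]
      exact fun hi => hi.trans_le (Nat.ceil_le.2 hsN)
    rw [h2]
    simp only [Finset.card_range, Finset.sum_const, Finset.card_univ, Fintype.card_fin,
      nsmul_eq_mul]
    linarith
  rw [hcount, abs_le]
  have h3 := Nat.le_ceil s
  have h4 := Nat.ceil_lt_add_one hs0
  constructor <;> nlinarith

variable {d : ℕ} {G : Digraph (Fin d)} {α : ℝ} {σ : ℝ → ℝ}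

/-- The structural equation of a layer with soft steps of height `h` at the positions `τ`. -/
def stepLayer {ι : Type} {N : ℕ} (α w h : ℝ) (τ : Fin N → (ι → ℝ) → ℝ) (p : (ι → ℝ) × ℝ) : ℝ :=
  ∑ i, h / 2 * rho α (w * (p.2 - τ i p.1))

lemma isLayer_stepLayer {k : Fin d} {N : ℕ} (hN : 0 < N) {w h : ℝ} (hw : 0 < w) (hh : 0 < h)
    {τ : Fin N → (parents G k → ℝ) → ℝ} (hτ : ∀ i, IsMLP σ (τ i)) :
    IsLayer G α σ k (stepLayer α w h τ) := by
  -- Only the inner biases depend on the parents, so the positive weights are constants and no sign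
  -- constraint falls on the perceptrons.
  refine ⟨N, hN, fun z => (fun _ => w, fun i => -w * τ i z, fun _ => h / 2, 0), ?_,
    fun z => ⟨fun _ => hw, fun _ => half_pos hh⟩, ?_⟩
  · have h1 := (IsMLP.const (ι := parents G k) σ
      ((fun _ => w, 0, fun _ => h / 2, 0) : RawParam N)).add
      (IsMLP.sum Finset.univ fun i _ => (hτ i).map
        (LinearMap.inr ℝ (Fin N → ℝ) _ ∘ₗ LinearMap.inl ℝ (Fin N → ℝ) ((Fin N → ℝ) × ℝ) ∘ₗ
          LinearMap.single ℝ (fun _ : Fin N => ℝ) i ∘ₗ ((-w) • LinearMap.id)))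
    convert h1 using 2 with z
    ext i <;> simp [Prod.fst_sum, Prod.snd_sum, Finset.sum_apply, Pi.single_apply]
  · funext p
    simp only [stepLayer, incrMLP, add_zero]
    refine Finset.sum_congr rfl fun i _ => ?_
    ring_nf

/-- Three errors add up: the clamp differs from the jump only within 1/w of c, moving the threshold
from c to s costs w|c - s|, and the leak costs at most αw(1 + |c - s|). Since α < 1, the last |c -
s| term doubles the second error. -/
lemma abs_sub_rho_le {α w u c s : ℝ} (hα : α ∈ Set.Ioo (0 : ℝ) 1) (hw : 0 < w)
    (hu : u ∈ Set.Icc (0 : ℝ) 1) (hc : c ∈ Set.Icc (0 : ℝ) 1) :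
    |(if c < u then 1 else -1) - rho α (w * (u - s))| ≤
      2 * {x | |u - x| < 1 / w}.indicator 1 c + (2 * w * |c - s| + α * w) := by
  have h1 : |(if c < u then 1 else -1) - clampUnit (w * (u - c))| ≤
      2 * {x | |u - x| < 1 / w}.indicator 1 c := by
    by_cases hcu : |u - c| < 1 / w
    · rw [Set.indicator_of_mem (by exact hcu), Pi.one_apply]
      have h2 := abs_clampUnit_le_one (w * (u - c))
      refine (abs_sub _ _).trans ?_
      split_ifs <;> norm_num <;> linarith
    · rw [Set.indicator_of_notMem (by exact hcu), mul_zero]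
      rw [not_lt, div_le_iff₀ hw] at hcu
      split_ifs with h
      · rw [abs_of_pos (sub_pos.2 h)] at hcu
        rw [clampUnit_of_one_le (by linarith), sub_self, abs_zero]
      · rw [abs_of_nonpos (sub_nonpos.2 (not_lt.1 h))] at hcu
        rw [clampUnit_of_le_neg_one (by linarith), sub_self, abs_zero]
  have h2 : |clampUnit (w * (u - c)) - clampUnit (w * (u - s))| ≤ w * |c - s| := by
    refine (abs_clampUnit_sub_le _ _).trans_eq ?_
    rw [← mul_sub, abs_mul, abs_of_pos hw, sub_sub_sub_cancel_left, abs_sub_comm]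
  have h3 : |clampUnit (w * (u - s)) - rho α (w * (u - s))| ≤ α * (w * (1 + |c - s|)) := by
    rw [abs_sub_comm]
    refine (abs_rho_sub_clampUnit_le hα.1.le _).trans
      (mul_le_mul_of_nonneg_left ?_ hα.1.le)
    rw [abs_mul, abs_of_pos hw]
    refine mul_le_mul_of_nonneg_left ?_ hw.le
    have h4 : |u - c| ≤ 1 := abs_le.2 ⟨by linarith [hu.1, hc.2], by linarith [hu.2, hc.1]⟩
    linarith [abs_sub_le u c s]
  have h4 : α * (w * |c - s|) ≤ w * |c - s| :=
    mul_le_of_le_one_left (by positivity) hα.2.le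
  have h5 := abs_sub_le (if c < u then (1 : ℝ) else -1) (clampUnit (w * (u - c)))
    (rho α (w * (u - s)))
  have h6 := abs_sub_le (clampUnit (w * (u - c))) (clampUnit (w * (u - s)))
    (rho α (w * (u - s)))
  linarith

/-- A continuously differentiable family of functions with values in `[0, 1]` on a box extends to
a globally Lipschitz one. -/
lemma exists_lipschitz_extension {ι : Type} [Fintype ι] {F : ℝ × (ι → ℝ) → ℝ}
    (hF : ContDiff ℝ 1 F) {M : ℝ} (hM : 0 < M) :
    ∃ L ≥ 0, ∃ φ : ℝ → (ι → ℝ) → ℝ,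
      (∀ y ∈ Set.Icc (-M) M, ∀ z z', |φ y z - φ y z'| ≤ L * ∑ j, |z j - z' j|) ∧
      (∀ y z, φ y z ∈ Set.Icc 0 1) ∧ (∀ y, Measurable (φ y)) ∧
      ∀ y z, (∀ j, |z j| ≤ M) → F (y, z) ∈ Set.Icc 0 1 → φ y z = F (y, z) := by
  set K : Set (ℝ × (ι → ℝ)) := Set.Icc (-M) M ×ˢ Set.Icc (fun _ => -M) (fun _ => M)
  obtain ⟨L, hL⟩ := (hF.locallyLipschitz.locallyLipschitzOn (s := K)).exists_lipschitzOnWith_of_compact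
    (isCompact_Icc.prod isCompact_Icc)
  let pr : (ι → ℝ) → ι → ℝ := fun z j => max (-M) (min M (z j))
  have hpr : ∀ z, pr z ∈ Set.Icc (fun _ : ι => -M) (fun _ => M) := fun z =>
    ⟨fun j => le_max_left _ _, fun j => max_le (by linarith) (min_le_left _ _)⟩
  have hprd : ∀ z z', dist (pr z) (pr z') ≤ ∑ j, |z j - z' j| := fun z z' => by
    rw [dist_pi_le_iff (Finset.sum_nonneg fun _ _ => abs_nonneg _)]
    intro j
    refine le_trans ?_ (Finset.single_le_sum (f := fun j => |z j - z' j|)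
      (fun _ _ => abs_nonneg _) (Finset.mem_univ j))
    rw [Real.dist_eq]
    refine (abs_max_sub_max_le_max _ _ _ _).trans ?_
    rw [sub_self, abs_zero, max_eq_right (abs_nonneg _)]
    refine (abs_min_sub_min_le_max _ _ _ _).trans ?_
    rw [sub_self, abs_zero, max_eq_right (abs_nonneg _)]
  have hprm : Measurable pr := by
    refine measurable_pi_lambda _ fun j => ?_
    exact measurable_const.max (measurable_const.min (measurable_pi_apply j))
  -- Generated parents may leave the box and F need not be a cdf at every z, so both the argument
  -- and the value are clamped; neither clamp increases the Lipschitz constant.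
  refine ⟨L, L.2, fun y z => max 0 (min 1 (F (y, pr z))), fun y hy z z' => ?_,
    fun y z => ⟨le_max_left _ _, max_le zero_le_one (min_le_left _ _)⟩, fun y => ?_,
    fun y z hz hFz => ?_⟩
  · refine (abs_max_sub_max_le_max _ _ _ _).trans ?_
    rw [sub_self, abs_zero, max_eq_right (abs_nonneg _)]
    refine (abs_min_sub_min_le_max _ _ _ _).trans ?_
    rw [sub_self, abs_zero, max_eq_right (abs_nonneg _)]
    have h1 := hL.dist_le_mul (y, pr z) ⟨hy, hpr z⟩ (y, pr z') ⟨hy, hpr z'⟩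
    rw [Real.dist_eq] at h1
    refine h1.trans (mul_le_mul_of_nonneg_left ?_ L.2)
    rw [Prod.dist_eq, dist_self, max_eq_right dist_nonneg]
    exact hprd z z'
  · exact measurable_const.max (measurable_const.min
      (hF.continuous.measurable.comp (measurable_const.prodMk hprm)))
  · have : pr z = z := funext fun j => by
      have := abs_le.1 (hz j)
      simp only [pr]
      rw [min_eq_right this.2, max_eq_right this.1]
    simp only
    rw [this, min_eq_right hFz.2, max_eq_right hFz.1]

end

section

variable {d : ℕ} {G : Digraph (Fin d)} {α : ℝ} {σ : ℝ → ℝ}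
  {ν : Fin d → Measure ℝ} [∀ i, IsProbabilityMeasure (ν i)]
  {f : ∀ i : Fin d, (parents G i → ℝ) × ℝ → ℝ}
  {F : ∀ k : Fin d, ℝ × (parents G k → ℝ) → ℝ}

/-! ### Approximation of the conditional distribution functions layer by layer -/

/-- The threshold does not involve the k-th noise, so conditionally it is a fixed centre and a
uniform variable hits a window of length 2r with probability at most 2r. -/
lemma meanLE_abs_rosenblatt_sub_lt (hG : IsSortedDAG G) (hf : ∀ i, Measurable (f i))
    (hF : IsSCMCondCDF ν f F) (hFc : ∀ k, Continuous (F k)) (k : Fin d) (y : ℝ) {r : ℝ}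
    (hr : 0 < r) :
    MeanLE (Measure.pi ν) (fun v => {x | |rosenblatt G F (scm G f v) k - x| < r}.indicator 1
      (F k (y, slice G k (scm G f v)))) (2 * r) := by
  have hX := measurable_scm hf
  have hc : Measurable fun v => F k (y, slice G k (scm G f v)) :=
    (hFc k).measurable.comp (measurable_const.prodMk ((measurable_slice k).comp hX))
  have hR : Measurable fun v => rosenblatt G F (scm G f v) k :=
    (measurable_pi_apply k).comp ((measurable_rosenblatt hFc).comp hX)
  let S : Set ((Fin d → ℝ) × ℝ) := {p | |p.2 - F k (y, slice G k (scm G f p.1))| < r}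
  have hS : MeasurableSet S :=
    measurableSet_lt (measurable_snd.sub (hc.comp measurable_fst)).abs measurable_const
  have hind : ∀ v : Fin d → ℝ, {x | |rosenblatt G F (scm G f v) k - x| < r}.indicator (1 : ℝ → ℝ)
      (F k (y, slice G k (scm G f v))) =
        S.indicator (1 : (Fin d → ℝ) × ℝ → ℝ) (v, rosenblatt G F (scm G f v) k) := fun v => rfl
  simp only [hind]
  refine ⟨(measurable_one.indicator hS).comp (measurable_id.prodMk hR), by positivity, ?_⟩
  rw [lintegral_rosenblatt hG hf hF hFc k
    (H := fun p => ENNReal.ofReal (S.indicator (1 : (Fin d → ℝ) × ℝ → ℝ) p))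
    (measurable_one.indicator hS).ennreal_ofReal]
  · refine (lintegral_mono (g := fun _ => ENNReal.ofReal (2 * r)) fun v => ?_).trans_eq (by simp)
    have h1 : ∀ u : ℝ, ENNReal.ofReal (S.indicator (1 : (Fin d → ℝ) × ℝ → ℝ) (v, u)) =
        (Metric.ball (F k (y, slice G k (scm G f v))) r).indicator 1 u := fun u => by
      by_cases h : (v, u) ∈ S
      · rw [Set.indicator_of_mem h, Set.indicator_of_mem (by exact h)]
        simp
      · rw [Set.indicator_of_notMem h, Set.indicator_of_notMem (by exact h)]
        simp
    simp only [h1]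
    rw [lintegral_indicator_one Metric.isOpen_ball.measurableSet, ← Real.volume_ball]
    exact Measure.restrict_apply_le _ _
  · intro v y' u
    have h1 : (Function.update v k y', u) ∈ S ↔ (v, u) ∈ S := by
      simp only [S, Set.mem_ofPred_eq, slice_scm_update hG]
    by_cases h : (v, u) ∈ S
    · rw [Set.indicator_of_mem h, Set.indicator_of_mem (h1.2 h)]
      rfl
    · rw [Set.indicator_of_notMem h, Set.indicator_of_notMem (fun h' => h (h1.1 h'))]

/-- The error of a step layer in terms of the errors of the previous layers. -/
lemma meanLE_stepLayer (hG : IsSortedDAG G) (hf : ∀ i, Measurable (f i))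
    (hF : IsSCMCondCDF ν f F) (hFc : ∀ k, Continuous (F k))
    {M : ℝ} (hM : 0 < M) (hbd : ∀ᵐ v ∂(Measure.pi ν), ∀ k, |scm G f v k| ≤ M)
    (hα : α ∈ Set.Ioo (0 : ℝ) 1) {t : ∀ k : Fin d, (parents G k → ℝ) × ℝ → ℝ}
    (ht : ∀ k, Measurable (t k)) {k : Fin d} {N : ℕ} (hN : 0 < N) {w : ℝ} (hw : 0 < w)
    {τ : Fin N → (parents G k → ℝ) → ℝ} (htk : t k = stepLayer α w (2 * M / N) τ)
    {L : ℝ} (hL : 0 ≤ L) {φ : ℝ → (parents G k → ℝ) → ℝ}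
    (hφL : ∀ y ∈ Set.Icc (-M) M, ∀ z z', |φ y z - φ y z'| ≤ L * ∑ j, |z j - z' j|)
    (hφ : ∀ y z, (∀ j, |z j| ≤ M) → F k (y, z) ∈ Set.Icc 0 1 → φ y z = F k (y, z))
    {δ η : ℝ}
    (hδ : ∀ j < k, MeanLE (Measure.pi ν)
      (fun v => |scm G f v j - scm G t (rosenblatt G F (scm G f v)) j|) δ)
    (hη : ∀ i : Fin N, MeanLE (Measure.pi ν)
      (fun v => |φ (-M + i * (2 * M / N))
          (slice G k (scm G t (rosenblatt G F (scm G f v)))) -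
        τ i (slice G k (scm G t (rosenblatt G F (scm G f v))))|) η) :
    MeanLE (Measure.pi ν)
      (fun v => |scm G f v k - scm G t (rosenblatt G F (scm G f v)) k|)
      (2 * M / N + M * (2 * (2 * (1 / w)) +
        (2 * w * (L * (Fintype.card (parents G k) * δ) + η) + α * w))) := by
  have hN' : (0 : ℝ) < N := by exact_mod_cast hN
  have hX := measurable_scm hf
  have hW : Measurable fun v => rosenblatt G F (scm G f v) := (measurable_rosenblatt hFc).comp hX
  have hY : Measurable fun v => scm G t (rosenblatt G F (scm G f v)) :=
    (measurable_scm ht).comp hW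
  have hh : 0 < 2 * M / N := by positivity
  have hαw : 0 ≤ α * w := mul_nonneg hα.1.le hw.le
  have hpar : MeanLE (Measure.pi ν) (fun v => ∑ j : parents G k,
      |scm G f v j - scm G t (rosenblatt G F (scm G f v)) j|)
      (Fintype.card (parents G k) * δ) :=
    MeanLE.sum fun j => hδ j (hG _ _ (adj_of_mem_parents j))
  have hterm := fun i : Fin N =>
    (((meanLE_abs_rosenblatt_sub_lt hG hf hF hFc k (-M + i * (2 * M / N))
      (one_div_pos.2 hw)).const_mul zero_le_two).add
      ((((hpar.const_mul hL).add (hη i)).const_mul (by positivity : 0 ≤ 2 * w)).add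
        (MeanLE.const hαw))).const_mul (half_pos hh).le
  refine ((MeanLE.const (P := Measure.pi ν) hh.le).add (MeanLE.sum hterm)).mono
    (((measurable_pi_apply k).comp hX).sub ((measurable_pi_apply k).comp hY)).abs ?_ ?_
  -- N neurons of half-height M/N contribute total weight M, so refining the grid does not amplify
  -- the errors of the single steps.
  · rw [Fintype.card_fin, ← mul_assoc, show (N : ℝ) * (2 * M / N / 2) = M by field_simp]
  · filter_upwards [hbd, ae_rosenblatt hG hf hF hFc,
      ae_of_ae_map hW.aemeasurable (by rw [map_rosenblatt hG hf hF hFc]; exact ae_unifCube_mem k)]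
      with v hv1 hv2 hv3
    obtain ⟨h1, h2, h3⟩ := hv2 k
    set x := scm G f v
    set u := rosenblatt G F x
    set y := scm G t u with hy
    have hyk : y k = ∑ i, 2 * M / N / 2 * rho α (w * (u k - τ i (slice G k y))) := by
      rw [hy, scm_apply hG, ← hy, htk, stepLayer]
    -- The crucial exchange: a jump of the staircase in X_k becomes a jump in the uniform variable
    -- at a threshold depending only on the parents.
    have hiff : ∀ a, (a < x k ↔ F k (a, slice G k x) < u k) := fun a =>
      ⟨h1 a, fun h => not_le.1 fun h' => absurd (h2 a h') (not_le.2 h)⟩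
    refine (abs_sub_le _ _ _).trans (add_le_add (abs_sub_staircase_le hN hM (hv1 k)) ?_)
    rw [hyk, ← Finset.sum_sub_distrib]
    refine (Finset.abs_sum_le_sum_abs _ _).trans (Finset.sum_le_sum fun i _ => ?_)
    rw [← mul_sub, abs_mul, abs_of_pos (half_pos hh)]
    refine mul_le_mul_of_nonneg_left ?_ (half_pos hh).le
    simp only [hiff]
    refine (abs_sub_rho_le hα hw hv3 (h3 _)).trans (add_le_add le_rfl (add_le_add ?_ le_rfl))
    refine mul_le_mul_of_nonneg_left ?_ (by positivity)
    rw [← hφ (-M + i * (2 * M / N)) (slice G k x) (fun j => hv1 j) (h3 _)]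
    refine (abs_sub_le _ _ _).trans (add_le_add (hφL _ ?_ _ _) le_rfl)
    have hi : (i : ℝ) ≤ N := by exact_mod_cast i.2.le
    have h4 : (i : ℝ) * (2 * M / N) ≤ 2 * M := by
      calc (i : ℝ) * (2 * M / N) ≤ N * (2 * M / N) := by gcongr
        _ = 2 * M := by field_simp
    have h5 : 0 ≤ (i : ℝ) * (2 * M / N) := by positivity
    exact ⟨by linarith, by linarith⟩

/-- Density is applied under the law of the generated parents, at which the perceptron is actually
evaluated. As σ may be discontinuous, accuracy at the true parents would not transfer. -/
lemma exists_isMLP_meanLE (hG : IsSortedDAG G) (hσ : IsMLPActivation σ)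
    (hf : ∀ i, Measurable (f i)) (hF : IsSCMCondCDF ν f F) (hFc : ∀ k, Continuous (F k))
    (hα : α ∈ Set.Ioo (0 : ℝ) 1) {t : ∀ k : Fin d, (parents G k → ℝ) × ℝ → ℝ}
    (ht : ∀ k, IsLayer G α σ k (t k)) (k : Fin d) {φ : (parents G k → ℝ) → ℝ}
    (hφ : Measurable φ) (hφ1 : ∀ z, φ z ∈ Set.Icc 0 1) {η : ℝ} (hη : 0 < η) :
    ∃ τ : (parents G k → ℝ) → ℝ, IsMLP σ τ ∧ MeanLE (Measure.pi ν)
      (fun v => |φ (slice G k (scm G t (rosenblatt G F (scm G f v)))) -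
        τ (slice G k (scm G t (rosenblatt G F (scm G f v))))|) η := by
  have hT : Measurable (scm G t) := measurable_scm fun k => (ht k).measurable hσ
  have hW : Measurable fun v => rosenblatt G F (scm G f v) :=
    (measurable_rosenblatt hFc).comp (measurable_scm hf)
  have hsl : Measurable fun u => slice G k (scm G t u) := (measurable_slice k).comp hT
  have hp : IsProbabilityMeasure ((unifCube d).map fun u => slice G k (scm G t u)) :=
    Measure.isProbabilityMeasure_map hsl.aemeasurable
  obtain ⟨R, hR⟩ := exists_ae_abs_scm_le hG hσ hα ht
  have hR' : ∀ᵐ z ∂(unifCube d).map (fun u => slice G k (scm G t u)), ∀ i, |z i| ≤ R := by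
    rw [ae_map_iff hsl.aemeasurable]
    · exact hR.mono fun u hu i => hu i
    · rw [Set.ofPred_forall]
      exact MeasurableSet.iInter fun i =>
        measurableSet_le (measurable_pi_apply i).abs measurable_const
  have hmem : MemLp φ 2 ((unifCube d).map fun u => slice G k (scm G t u)) :=
    MemLp.of_bound hφ.aestronglyMeasurable 1 (ae_of_all _ fun z => by
      rw [Real.norm_of_nonneg (hφ1 z).1]
      exact (hφ1 z).2)
  obtain ⟨τ, hτ, hle⟩ := exists_isMLP_lintegral_le hσ
    (map_slice_scm_absolutelyContinuous hG hσ hα ht k) hR' hmem hη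
  have hm : Measurable fun z => |φ z - τ z| := (hφ.sub (hτ.measurable hσ)).abs
  have hms : Measurable fun u => ENNReal.ofReal
      |φ (slice G k (scm G t u)) - τ (slice G k (scm G t u))| := (hm.comp hsl).ennreal_ofReal
  refine ⟨τ, hτ, hm.comp (hsl.comp hW), hη.le, ?_⟩
  rwa [lintegral_map hm.ennreal_ofReal hsl, ← map_rosenblatt hG hf hF hFc,
    lintegral_map hms hW] at hle

/-- Approximation of the first `n` coordinates. -/
lemma exists_layers (hG : IsSortedDAG G) (hσ : IsMLPActivation σ)
    (hf : ∀ i, Measurable (f i)) (hF : IsSCMCondCDF ν f F) (hFc : ∀ k, ContDiff ℝ 1 (F k))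
    {M : ℝ} (hM : 0 < M) (hbd : ∀ᵐ v ∂(Measure.pi ν), ∀ k, |scm G f v k| ≤ M) (n : ℕ)
    {ε : ℝ} (hε : 0 < ε) :
    ∃ α₀ ∈ Set.Ioo (0 : ℝ) 1, ∀ α ∈ Set.Ioc (0 : ℝ) α₀,
      ∃ t : ∀ k : Fin d, (parents G k → ℝ) × ℝ → ℝ, (∀ k, IsLayer G α σ k (t k)) ∧
        ∀ j : Fin d, (j : ℕ) < n → MeanLE (Measure.pi ν)
          (fun v => |scm G f v j - scm G t (rosenblatt G F (scm G f v)) j|) ε := by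
  induction n generalizing ε with
  | zero =>
    refine ⟨1 / 2, by norm_num, fun α _ => ?_⟩
    choose t ht using fun k => exists_isLayer G α σ k
    exact ⟨t, ht, fun j hj => absurd hj (Nat.not_lt_zero _)⟩
  | succ n ih =>
    rcases le_or_gt d n with hdn | hnd
    · obtain ⟨α₀, h0, h⟩ := ih hε
      refine ⟨α₀, h0, fun α hα => ?_⟩
      obtain ⟨t, ht1, ht2⟩ := h α hα
      exact ⟨t, ht1, fun j _ => ht2 j (j.2.trans_le hdn)⟩
    set k : Fin d := ⟨n, hnd⟩ with hk
    have hFc' : ∀ k, Continuous (F k) := fun k => (hFc k).continuous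
    obtain ⟨L, hL, φ, hφL, hφ1, hφm, hφ⟩ := exists_lipschitz_extension (hFc k) hM
    obtain ⟨N, hN⟩ := exists_nat_gt (8 * M / ε)
    have hN' : (0 : ℝ) < N := lt_trans (by positivity) hN
    have hN0 : 0 < N := by exact_mod_cast hN'
    -- The smoothing error 4M/w is then exactly ε/4; likewise the choice of N makes the mesh at most
    -- ε/4.
    set w := 16 * M / ε with hw
    have hwpos : 0 < w := by positivity
    set p : ℝ := (Fintype.card (parents G k) : ℝ) with hp
    have hp0 : 0 ≤ p := Nat.cast_nonneg _
    set B := 2 * M * w * L * p with hB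
    have hB0 : 0 ≤ B := by positivity
    -- The first bound keeps the earlier coordinates within ε, the second limits their effect Bδ on
    -- coordinate k to ε/4; the added 1 covers B = 0.
    set δ := min ε (ε / (4 * (B + 1))) with hδ
    have hδ0 : 0 < δ := lt_min hε (by positivity)
    obtain ⟨α₁, hα₁, h⟩ := ih hδ0
    -- The thresholds are approximated to accuracy α, which costs 2αMw, and the leak costs αMw;
    -- together 3αMw ≤ ε/4.
    refine ⟨min α₁ (ε / (12 * M * w)), ⟨lt_min hα₁.1 (by positivity),
      (min_le_left _ _).trans_lt hα₁.2⟩, fun α hα => ?_⟩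
    obtain ⟨t, ht1, ht2⟩ := h α ⟨hα.1, hα.2.trans (min_le_left _ _)⟩
    have hα' : α ∈ Set.Ioo (0 : ℝ) 1 :=
      ⟨hα.1, (hα.2.trans (min_le_left _ _)).trans_lt hα₁.2⟩
    choose τ hτ1 hτ2 using fun i : Fin N => exists_isMLP_meanLE hG hσ hf hF hFc' hα' ht1 k
      (hφm (-M + i * (2 * M / N))) (hφ1 _) hα.1
    -- Replacing layer k leaves all coordinates below k unchanged, so the estimates for the
    -- generated parents under t remain valid.
    set t' := Function.update t k (stepLayer α w (2 * M / N) τ) with ht'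
    have hlayer : ∀ j, IsLayer G α σ j (t' j) := fun j => by
      by_cases hj : j = k
      · subst hj
        rw [ht', Function.update_self]
        exact isLayer_stepLayer hN0 hwpos (by positivity) hτ1
      · rw [ht', Function.update_of_ne hj]
        exact ht1 j
    have hsame : ∀ j < k, ∀ u, scm G t' u j = scm G t u j := fun j hj u =>
      scm_congr hG (fun i hi => by rw [ht', Function.update_of_ne (hi.trans_lt hj).ne])
        fun _ _ => rfl
    have hslice : ∀ u, slice G k (scm G t' u) = slice G k (scm G t u) := fun u =>
      slice_congr_of_lt hG fun j hj => hsame j hj u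
    have hprev : ∀ j < k, MeanLE (Measure.pi ν)
        (fun v => |scm G f v j - scm G t' (rosenblatt G F (scm G f v)) j|) δ := fun j hj => by
      simp only [hsame j hj]
      exact ht2 j hj
    refine ⟨t', hlayer, fun j hj => ?_⟩
    rcases (Nat.lt_succ_iff_lt_or_eq.1 hj) with hj | hj
    · have h1 := hprev j hj
      exact h1.mono h1.1 (min_le_left _ _) (ae_of_all _ fun _ => le_rfl)
    obtain rfl : j = k := Fin.ext hj
    have key := meanLE_stepLayer hG hf hF hFc' hM hbd hα' (fun j => (hlayer j).measurable hσ)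
      hN0 hwpos (by rw [ht', Function.update_self]) hL hφL hφ hprev
      (fun i => by simpa only [hslice] using hτ2 i)
    refine key.mono key.1 ?_ (ae_of_all _ fun _ => le_rfl)
    rw [← hp]
    have e1 : 2 * M / N ≤ ε / 4 := by
      rw [div_le_iff₀ hN']
      rw [div_lt_iff₀ hε] at hN
      linarith
    have e2 : M * (2 * (2 * (1 / w))) = ε / 4 := by
      rw [hw]; field_simp; norm_num
    have e3 : B * δ ≤ ε / 4 := by
      have h1 : δ * (4 * (B + 1)) ≤ ε := by
        rw [← le_div_iff₀ (by positivity)]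
        exact min_le_right _ _
      linarith
    have e4 : α * (12 * M * w) ≤ ε := by
      rw [← le_div_iff₀ (by positivity)]
      exact hα.2.trans (min_le_right _ _)
    have e5 : M * (2 * (2 * (1 / w)) + (2 * w * (L * (p * δ) + α) + α * w)) =
        M * (2 * (2 * (1 / w))) + B * δ + 3 * (α * M * w) := by
      rw [hB]; ring
    rw [e5, e2]
    linarith

end

end GCausal

end

theorem mainTheorem3 {d : ℕ} (G : Digraph (Fin d)) (hG : GCausal.IsSortedDAG G)
    (σ : ℝ → ℝ) (hσ : GCausal.IsMLPActivation σ)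
    (μ : MeasureTheory.Measure (Fin d → ℝ)) (hμ : μ ∈ GCausal.PG1 G)
    (hac : MeasureTheory.Measure.AbsolutelyContinuous μ MeasureTheory.volume)
    (hsupp : IsCompact μ.support)
    (hF : ∀ k, GCausal.HasC1CondCDF G μ k)
    (ε : ℝ) (hε : 0 < ε) :
    ∃ α₀ ∈ Set.Ioo (0 : ℝ) 1, ∀ α ∈ Set.Ioc (0 : ℝ) α₀,
      ∃ T : (Fin d → ℝ) → (Fin d → ℝ), GCausal.IsGCausalNF G α σ T ∧
        (GCausal.unifCube d).map T ∈ GCausal.PG1 G ∧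
        GCausal.WG G μ ((GCausal.unifCube d).map T) ≤ ENNReal.ofReal ε := by
  obtain ⟨ν, f, hν, hf, rfl⟩ := hμ.2.1.exists_scm hG
  have hX := GCausal.measurable_scm hf
  obtain ⟨F, hFc, hFcdf⟩ := GCausal.exists_isSCMCondCDF hG hf hF
  have hFc' : ∀ k, Continuous (F k) := fun k => (hFc k).continuous
  obtain ⟨M, hM0, hM⟩ := hsupp.isBounded.exists_pos_norm_le
  have hbd : ∀ᵐ v ∂(MeasureTheory.Measure.pi ν), ∀ k, |GCausal.scm G f v k| ≤ M := by
    filter_upwards [MeasureTheory.ae_of_ae_map hX.aemeasurable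
      MeasureTheory.Measure.support_mem_ae] with v hv k
    exact (norm_le_pi_norm (GCausal.scm G f v) k).trans (hM _ hv)
  -- The accuracy is shared among the d coordinates; d + 1 in the denominator keeps it positive and
  -- well defined when d = 0.
  obtain ⟨α₀, h0, h⟩ := GCausal.exists_layers hG hσ hf hFcdf hFc hM0 hbd d
    (ε := ε / (d + 1)) (by positivity)
  refine ⟨α₀, h0, fun α hα => ?_⟩
  obtain ⟨t, ht, hmean⟩ := h α hα
  have hα' : α ∈ Set.Ioo (0 : ℝ) 1 := ⟨hα.1, hα.2.trans_lt h0.2⟩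
  refine ⟨GCausal.scm G t, GCausal.isGCausalNF_scm ht, GCausal.map_scm_mem_PG1 hG hσ hα' ht, ?_⟩
  refine (GCausal.WG_le_sum hG hf hFcdf hFc' (fun k => (ht k).measurable hσ)
    fun k z => (ht k).strictMono hα' z).trans ?_
  refine (Finset.sum_le_sum fun k _ => (hmean k k.2).2.2).trans ?_
  rw [Finset.sum_const, Finset.card_univ, Fintype.card_fin, nsmul_eq_mul,
    ← ENNReal.ofReal_natCast, ← ENNReal.ofReal_mul (Nat.cast_nonneg _)]
  refine ENNReal.ofReal_le_ofReal ?_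
  rw [mul_div_assoc', div_le_iff₀ (by positivity)]
  nlinarith
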